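/- **Setting.** An object type is a (possibly nondeterministic) sequential specification in which every operation is enabled in every state. Processes are asynchronous, communicate by atomic accesses to non-volatile shared objects, and are subject to independent crashes: at any time a single process may crash, which erases its local state but leaves the shared memory unchanged. An $n$-process algorithm for recoverable consensus (RC) gives each process a deterministic routine that takes an input value and returns an output value; a process that crashes later starts its routine again from the beginning with the same input. The algorithm solves RC if in every execution (i) no two outputs are different (whether of different processes or of one process in different runs), (ii) every output is the input of some process, and (iii) a process that executes its routine from the beginning either crashes or outputs a value after finitely many of its own steps. Inputs may come from an arbitrary set. For an object type $T$, $rcons(T)\in\mathbb{N}\cup\{\infty\}$ is the maximum $n$ for which $n$-process RC can be solved, in the presence of independent crashes, using any (possibly infinite) number of atomic objects of type $T$, with arbitrary initial states, and read/write registers, or $\infty$ if there is no maximum. An implementation of $T_2$ from atomic objects of type $T_1$ and registers for $n$ processes gives, for each process, a routine for each operation of $T_2$ and a recovery function (possibly trivial), which a process executes when it recovers from a crash, before doing anything else. It is wait-free if every process completes each operation or recovery function that it executes within finitely many of its own steps unless it crashes. It is persistently linearizable if in every (finite or infinite) execution, in which processes invoke arbitrary operations on the implemented object and may perform operations on other objects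 in between, one can choose linearization points for all operations that return and for some of those that do not, such that performing the linearized operations atomically at these points, starting from the initial state, is consistent with the specification of $T_2$ and with the responses returned; the point of an operation lies after its invocation and before its response, and the point of an operation that is interrupted by a crash lies before the next operation (on any object) of the same process is invoked. **Theorem.** Let $T_1,T_2$ be object types and let $n\le rcons(T_2)$. If, for every initial state, an object of type $T_2$ has a wait-free, persistently linearizable implementation from atomic objects of type $T_1$ and registers in a system of $n$ processes with independent crashes, then $rcons(T_1)\ge n$. -/

import Mathlib

namespace RC

/-- A shared object type: a sequential specification, possibly nondeterministic. `step s o r s'` says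
that operation `o` (its name together with its arguments) applied in state `s` may return `r` and
leave the object in state `s'`. Every operation can be applied in every state. -/
structure ObjType where
  State : Type
  Op : Type
  Resp : Type
  step : State → Op → Resp → State → Prop
  total : ∀ s o, ∃ r s', step s o r s'

/-- A (possibly infinite) collection of initialised atomic base objects: objects of type `T` and
read/write registers. They are non-volatile. -/
structure Base (T : ObjType) where
  Obj : Type
  Reg : Type
  Val : Type
  objInit : Obj → T.State
  regInit : Reg → Val

/-- The contents of the shared memory. -/
structure Memory {T : ObjType} (B : Base T) where
  obj : B.Obj → T.State
  reg : B.Reg → B.Val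

/-- The initial contents of the shared memory. -/
def Base.initial {T : ObjType} (B : Base T) : Memory B where
  obj := B.objInit
  reg := B.regInit

/-- What a (deterministic) sequential routine does next in a given local state: one atomic access to
a base object, the next local state being a function of the response, or returning a result. -/
inductive Action {T : ObjType} (B : Base T) (Loc Out : Type) where
  | op (k : B.Obj) (o : T.Op) (cont : T.Resp → Loc)
  | read (r : B.Reg) (cont : B.Val → Loc)
  | write (r : B.Reg) (v : B.Val) (cont : Loc)
  | ret (out : Out)

open Classical in
/-- `Access a m m' l`: performing the shared-memory access `a` atomically may change the memory from
`m` to `m'` and brings the routine to the local state `l`. -/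
inductive Access {T : ObjType} {B : Base T} {Loc Out : Type} :
    Action B Loc Out → Memory B → Memory B → Loc → Prop
  | op (m : Memory B) (k : B.Obj) (o : T.Op) (cont : T.Resp → Loc) (r : T.Resp) (s : T.State)
      (h : T.step (m.obj k) o r s) :
      Access (.op k o cont) m { m with obj := Function.update m.obj k s } (cont r)
  | read (m : Memory B) (r : B.Reg) (cont : B.Val → Loc) :
      Access (.read r cont) m m (cont (m.reg r))
  | write (m : Memory B) (r : B.Reg) (v : B.Val) (cont : Loc) :
      Access (.write r v cont) m { m with reg := Function.update m.reg r v } cont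

/-! ### Recoverable consensus with independent crashes -/

/-- An `n`-process algorithm with inputs and outputs in `D`, using objects of type `T` and
registers: a routine for each process, which takes an input value. -/
structure Algorithm (T : ObjType) (n : ℕ) (D : Type) where
  base : Base T
  Loc : Type
  start : Fin n → D → Loc
  act : Loc → Action base Loc D

namespace Algorithm

variable {T : ObjType} {n : ℕ} {D : Type}

/-- The events of an execution: a shared-memory step of `p`, an output of `p` (which ends the
current run of `p`), a crash of `p`, or nothing at all. -/
inductive Event (n : ℕ) (D : Type) where
  | step (p : Fin n)
  | out (p : Fin n) (v : D)
  | crash (p : Fin n)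
  | pass

/-- A configuration. The local state `none` means that the process has finished its run. -/
structure Config (A : Algorithm T n D) where
  mem : Memory A.base
  loc : Fin n → Option A.Loc

/-- The initial configuration for given inputs. -/
def initial (A : Algorithm T n D) (input : Fin n → D) : A.Config where
  mem := A.base.initial
  loc := fun p => some (A.start p (input p))

/-- The transitions. A crash (possible at any time, also after an output) erases the local state of
one process, whose next step starts its routine from the beginning with the same input; the shared
memory is unaffected. -/
inductive Step (A : Algorithm T n D) (input : Fin n → D) :
    A.Config → Event n D → A.Config → Prop
  | step (c : A.Config) (p : Fin n) (l l' : A.Loc) (m : Memory A.base)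
      (hl : c.loc p = some l) (h : Access (A.act l) c.mem m l') :
      Step A input c (.step p) ⟨m, Function.update c.loc p (some l')⟩
  | out (c : A.Config) (p : Fin n) (l : A.Loc) (v : D)
      (hl : c.loc p = some l) (h : A.act l = .ret v) :
      Step A input c (.out p v) ⟨c.mem, Function.update c.loc p none⟩
  | crash (c : A.Config) (p : Fin n) :
      Step A input c (.crash p) ⟨c.mem, Function.update c.loc p (some (A.start p (input p)))⟩
  | pass (c : A.Config) : Step A input c .pass c

/-- An execution: `cfg t` is followed by the event `ev t`, which leads to `cfg (t + 1)`. Finite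
executions are those in which nothing happens from some time on. -/
structure Execution (A : Algorithm T n D) (input : Fin n → D) where
  cfg : ℕ → A.Config
  ev : ℕ → Event n D
  init : cfg 0 = A.initial input
  next : ∀ t, A.Step input (cfg t) (ev t) (cfg (t + 1))

/-- `A` solves recoverable consensus in the presence of independent crashes. -/
structure SolvesRC (A : Algorithm T n D) : Prop where
  /-- No two outputs (of different processes, or of one process in different runs) differ. -/
  agreement : ∀ (input : Fin n → D) (E : A.Execution input) (p q : Fin n) (v w : D) (t u : ℕ),
    E.ev t = .out p v → E.ev u = .out q w → v = w
  /-- Every output is the input of some process. -/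
  validity : ∀ (input : Fin n → D) (E : A.Execution input) (p : Fin n) (v : D) (t : ℕ),
    E.ev t = .out p v → ∃ q, input q = v
  /-- A process that does not crash any more takes only finitely many further steps. (A process that
  has not finished its run can always take a step or output a value, and it takes no step between an
  output and its next crash.) -/
  waitFree : ∀ (input : Fin n → D) (E : A.Execution input) (p : Fin n) (t₀ : ℕ),
    (∀ t, t₀ ≤ t → E.ev t ≠ .crash p) → ∃ t₁, ∀ t, t₁ ≤ t → E.ev t ≠ .step p

end Algorithm

/-- Recoverable consensus among `n` processes, for inputs from an arbitrary set, can be solved using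
objects of type `T` and registers when independent crashes may occur. -/
def RCSolvable (T : ObjType) (n : ℕ) : Prop :=
  ∀ D : Type, ∃ A : Algorithm T n D, A.SolvesRC

/-- The independent RC number of `T`: the maximum number of processes that can solve recoverable
consensus using objects of type `T` and registers, or `∞` if there is no maximum. -/
noncomputable def rcons (T : ObjType) : ℕ∞ :=
  ⨆ (n : ℕ) (_ : RCSolvable T n), (n : ℕ∞)

/-! ### Implementations in the independent crash-recovery model -/

/-- An implementation of one object of type `T₂` for `n` processes from atomic objects of type `T₁`
and registers: for each process, a routine for each operation, and a recovery function, which a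
process executes when it recovers from a crash. (The absence of a recovery function is the case
where it returns immediately.) -/
structure Implementation (T₁ T₂ : ObjType) (n : ℕ) where
  base : Base T₁
  Loc : Type
  start : Fin n → T₂.Op → Loc
  act : Loc → Action base Loc T₂.Resp
  RecLoc : Type
  recStart : Fin n → RecLoc
  recAct : RecLoc → Action base RecLoc Unit

namespace Implementation

variable {T₁ T₂ : ObjType} {n : ℕ}

/-- The events of an execution of an implementation. -/
inductive Event (T₂ : ObjType) (n : ℕ) where
  /-- `p` invokes the operation `o` on the implemented object. -/
  | inv (p : Fin n) (o : T₂.Op)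
  /-- `p` takes an internal step: an access to a base object. -/
  | step (p : Fin n)
  /-- The operation of `p` returns the response `r`. -/
  | resp (p : Fin n) (r : T₂.Resp)
  /-- `p` crashes. -/
  | crash (p : Fin n)
  /-- `p` completes its recovery function. -/
  | recovered (p : Fin n)
  /-- `p` performs an operation on some other object. -/
  | other (p : Fin n)
  | pass

/-- What a process is doing: nothing on this object, executing an operation, or recovering. -/
inductive Status (I : Implementation T₁ T₂ n) where
  | idle
  | busy (l : I.Loc)
  | recovering (l : I.RecLoc)

structure Config (I : Implementation T₁ T₂ n) where
  mem : Memory I.base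
  status : Fin n → I.Status

/-- The initial configuration. -/
def initial (I : Implementation T₁ T₂ n) : I.Config where
  mem := I.base.initial
  status := fun _ => .idle

/-- The transitions. Processes that are idle invoke arbitrary operations on this or on other objects.
A crash can happen at any time; it erases the local state of one process, which then executes its
recovery function from the beginning before it does anything else. -/
inductive Step (I : Implementation T₁ T₂ n) : I.Config → Event T₂ n → I.Config → Prop
  | inv (c : I.Config) (p : Fin n) (o : T₂.Op) (hp : c.status p = .idle) :
      Step I c (.inv p o) ⟨c.mem, Function.update c.status p (.busy (I.start p o))⟩
  | step (c : I.Config) (p : Fin n) (l l' : I.Loc) (m : Memory I.base)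
      (hp : c.status p = .busy l) (h : Access (I.act l) c.mem m l') :
      Step I c (.step p) ⟨m, Function.update c.status p (.busy l')⟩
  | resp (c : I.Config) (p : Fin n) (l : I.Loc) (r : T₂.Resp)
      (hp : c.status p = .busy l) (h : I.act l = .ret r) :
      Step I c (.resp p r) ⟨c.mem, Function.update c.status p .idle⟩
  | crash (c : I.Config) (p : Fin n) :
      Step I c (.crash p) ⟨c.mem, Function.update c.status p (.recovering (I.recStart p))⟩
  | recStep (c : I.Config) (p : Fin n) (l l' : I.RecLoc) (m : Memory I.base)
      (hp : c.status p = .recovering l) (h : Access (I.recAct l) c.mem m l') :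
      Step I c (.step p) ⟨m, Function.update c.status p (.recovering l')⟩
  | recovered (c : I.Config) (p : Fin n) (l : I.RecLoc)
      (hp : c.status p = .recovering l) (h : I.recAct l = .ret ()) :
      Step I c (.recovered p) ⟨c.mem, Function.update c.status p .idle⟩
  | other (c : I.Config) (p : Fin n) (hp : c.status p = .idle) : Step I c (.other p) c
  | pass (c : I.Config) : Step I c .pass c

/-- An execution: `cfg t` is followed by the event `ev t`, which leads to `cfg (t + 1)`. Finite
executions are those in which nothing happens from some time on. -/
structure Execution (I : Implementation T₁ T₂ n) where
  cfg : ℕ → I.Config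
  ev : ℕ → Event T₂ n
  init : cfg 0 = I.initial
  next : ∀ t, I.Step (cfg t) (ev t) (cfg (t + 1))

/-- A process that takes infinitely many steps and does not crash any more completes whatever
operation or recovery function it is executing. -/
def WaitFree (I : Implementation T₁ T₂ n) : Prop :=
  ∀ (E : I.Execution) (p : Fin n) (t₀ : ℕ),
    (∀ t, t₀ ≤ t → E.ev t ≠ .crash p) → (∀ t, ∃ u, t ≤ u ∧ E.ev u = .step p) →
    ∃ t, t₀ ≤ t ∧ (E.cfg t).status p = .idle

/-- The operation that `p` invoked at time `i` returns `r` at time `j`: a response of `p` belongs to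
the last operation that `p` invoked before it. -/
def Execution.Returns {I : Implementation T₁ T₂ n} (E : I.Execution)
    (p : Fin n) (i j : ℕ) (r : T₂.Resp) : Prop :=
  i < j ∧ (∃ o, E.ev i = .inv p o) ∧ E.ev j = .resp p r ∧
    ∀ k, i < k → k < j → ∀ o, E.ev k ≠ .inv p o

/-- `Applies ev s w s'`: performing the operations listed in `w` (named by their invocation times,
and paired with their responses), one after the other, may bring an object of type `T₂` from state
`s` to state `s'`. -/
inductive Applies (ev : ℕ → Event T₂ n) : T₂.State → List (ℕ × T₂.Resp) → T₂.State → Prop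
  | nil (s : T₂.State) : Applies ev s [] s
  | cons (s s' s'' : T₂.State) (i : ℕ) (p : Fin n) (o : T₂.Op) (r : T₂.Resp)
      (w : List (ℕ × T₂.Resp)) (hi : ev i = .inv p o) (h : T₂.step s o r s')
      (hw : Applies ev s' w s'') : Applies ev s ((i, r) :: w) s''

/-- A choice of linearization points that witnesses persistent linearizability of an execution, for
an object with initial state `q₀`. Operations are named by their invocation times. -/
structure PersistentLinearization {I : Implementation T₁ T₂ n} (E : I.Execution)
    (q₀ : T₂.State) where
  /-- The operations linearized immediately before the event at time `t` (and after the previous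
  event), in this order, with the responses that they get. -/
  lin : ℕ → List (ℕ × T₂.Resp)
  /-- The state of the object before the operations in `lin t`. -/
  state : ℕ → T₂.State
  state_zero : state 0 = q₀
  legal : ∀ t, Applies E.ev (state t) (lin t) (state (t + 1))
  /-- No operation is linearized twice. -/
  nodup : ∀ t, ((lin t).map Prod.fst).Nodup
  unique : ∀ i r r' t t', (i, r) ∈ lin t → (i, r') ∈ lin t' → t = t'
  /-- An operation is linearized after its invocation. -/
  after_inv : ∀ i r t, (i, r) ∈ lin t → i < t
  /-- An operation that returns is linearized before it does so, with the response that it returns. -/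
  before_resp : ∀ p i j r, E.Returns p i j r → ∃ t, t ≤ j ∧ (i, r) ∈ lin t
  /-- An operation (in particular one interrupted by a crash), if it is linearized at all, is
  linearized before the next operation of the same process is invoked. -/
  before_next : ∀ i r t p o, (i, r) ∈ lin t → E.ev i = .inv p o →
    ∀ j, i < j → j < t → E.ev j ≠ .other p ∧ ∀ o', E.ev j ≠ .inv p o'

/-- All executions are persistently linearizable, for the initial state `q₀`. -/
def PersistentlyLinearizable (I : Implementation T₁ T₂ n) (q₀ : T₂.State) : Prop :=
  ∀ E : I.Execution, Nonempty (PersistentLinearization E q₀)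

end Implementation

/-- Objects of type `T₂`, with any initial state, have wait-free, persistently linearizable
implementations from atomic objects of type `T₁` and registers, in a system of `n` processes with
independent crashes. -/
def Implementable (T₁ T₂ : ObjType) (n : ℕ) : Prop :=
  ∀ q₀ : T₂.State, ∃ I : Implementation T₁ T₂ n, I.WaitFree ∧ I.PersistentlyLinearizable q₀

end RC

namespace RC

/-! Take an RC algorithm `A` over `T₂` and run it with every object replaced by its implementation
from `T₁`. The difficulty is recovery: there may be infinitely many implemented objects, so a
restarted process cannot run all their recovery functions. Each process therefore records in a
register `cur p` the object on which it last invoked an operation. After a crash it recovers only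
that object, takes one dummy step, and then restarts the routine of `A`. On every other object it
was idle, so the crash can be hidden from it, and each object sees a legal execution of its own
implementation (`Step.project`).

Now choose linearization points for each object. An execution of `A` on atomic objects is obtained
by performing every operation at its linearization point. An operation interrupted by a crash may
take effect after the crash, so the simulated crash is postponed to the dummy step. That step counts
as an operation on another object, and persistent linearizability forbids the interrupted operation
to take effect after it. Until then the simulated process still waits in its old run
(`Trace.ghost_eq_pend_of_mem_lin`), so the operation is a legitimate step of that run.

Outputs are the same in both executions, which gives agreement and validity. If a process stops
crashing but takes steps forever, wait-freedom of the implementations makes it start its last run of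
`A` and then complete operation after operation. It would take infinitely many simulated steps
without further simulated crashes, contradicting wait-freedom of `A` (`solvesRC`). Finally, `n ≤
rcons T₂` yields an `n`-process algorithm because solvability passes to fewer processes
(`RCSolvable.of_le`). -/

theorem exists_seq_of_step {α : Type*} (P : ℕ → α → Prop) (R : ℕ → α → α → Prop) (a : α)
    (h₀ : P 0 a) (h : ∀ t x, P t x → ∃ y, P (t + 1) y ∧ R t x y) :
    ∃ f : ℕ → α, f 0 = a ∧ ∀ t, P t (f t) ∧ R t (f t) (f (t + 1)) := by
  choose! next hP hR using h
  let f : ℕ → α := fun t => Nat.rec a (fun t x => next t x) t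
  have hf : ∀ t, P t (f t) := fun t => by
    induction t with
    | zero => exact h₀
    | succ t ih => exact hP t _ ih
  exact ⟨f, rfl, fun t => ⟨hf t, hR t _ (hf t)⟩⟩

namespace Composition

variable {T₁ T₂ : ObjType} {n : ℕ} {D : Type}

/-! ### Running an algorithm on implemented objects -/

section Defs

variable (A : Algorithm T₂ n D) (I : A.base.Obj → Implementation T₁ T₂ n)

/-- The registers of the composed algorithm: those of `A`, those of the implementations, and for
each process one that holds the object on which it last invoked an operation. -/
inductive Reg : Type
  | outer (r : A.base.Reg)
  | inner (k : A.base.Obj) (r : (I k).base.Reg)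
  | cur (p : Fin n)

variable {A I} in
/-- The type of the contents of a register. -/
def Reg.Val : Reg A I → Type
  | .outer _ => A.base.Val
  | .inner k _ => (I k).base.Val
  | .cur _ => Option A.base.Obj

/-- The contents of the shared memory, arranged by implemented objects. -/
structure Mem where
  inner : ∀ k, Memory (I k).base
  outer : A.base.Reg → A.base.Val
  cur : Fin n → Option A.base.Obj

def Mem.initial : Mem A I where
  inner k := (I k).base.initial
  outer := A.base.regInit
  cur _ := none

variable {A I} in
def Mem.get (m : Mem A I) : ∀ r : Reg A I, r.Val
  | .outer r => m.outer r
  | .inner k r => (m.inner k).reg r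
  | .cur p => m.cur p

/-- The model has a single type of register values, whereas the registers here hold data of
different types. Each value is therefore tagged with the register that holds it. -/
abbrev base : Base T₁ where
  Obj := Σ k, (I k).base.Obj
  Reg := Reg A I
  Val := Σ r : Reg A I, r.Val
  objInit x := (I x.1).base.objInit x.2
  regInit r := ⟨r, (Mem.initial A I).get r⟩

variable {A I} in
def Mem.encode (m : Mem A I) : Memory (base A I) where
  obj x := (m.inner x.1).obj x.2
  reg r := ⟨r, m.get r⟩

/-- The phases of a process. In `boot` it looks up which object it has to recover; in `pre` it is
about to start the routine of `A`. -/
inductive Loc : Type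
  | boot
  | recover (k : A.base.Obj) (l : (I k).RecLoc)
  | pre
  | run (l : A.Loc)
  | busy (k : A.base.Obj) (cont : T₂.Resp → A.Loc) (l : (I k).Loc)

open Classical in
variable {A I} in
-- The default `.boot` is never reached: in a memory of the form `Mem.encode m`, the tag always
-- agrees with the register.
noncomputable def readReg (p : Fin n) (x : D) (r : Reg A I) (f : r.Val → Loc A I) :
    Action (base A I) (Fin n × D × Loc A I) D :=
  .read r fun v => (p, x, if h : v.1 = r then f (h ▸ v.2) else .boot)

open Classical in
variable {A I} in
/-- Runs an action of the implementation of the object `k`. -/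
noncomputable def lift {L Out : Type} (p : Fin n) (x : D) (k : A.base.Obj) (f : L → Loc A I)
    (onRet : Out → Action (base A I) (Fin n × D × Loc A I) D) :
    Action (I k).base L Out → Action (base A I) (Fin n × D × Loc A I) D
  | .op y o cont => .op ⟨k, y⟩ o fun r => (p, x, f (cont r))
  | .read r cont => readReg p x (.inner k r) fun v => f (cont v)
  | .write r v cont => .write (Reg.inner k r) ⟨.inner k r, v⟩ (p, x, f cont)
  | .ret out => onRet out

variable {A I} in
-- A return inside an implementation, of an operation or of a recovery function, costs a step here,
-- so it is realised by a read of `cur p` whose value is ignored. The read in `pre` is a dummy too: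
-- it plays the operation on another object that separates recovery from the new run. Writing `cur
-- p` coincides with the invocation, so no crash can fall between them.
noncomputable def act (p : Fin n) (x : D) : Loc A I → Action (base A I) (Fin n × D × Loc A I) D
  | .boot => readReg p x (.cur p) fun v => match (v : Option A.base.Obj) with
    | none => .pre
    | some k => .recover k ((I k).recStart p)
  | .recover k l =>
    lift p x k (.recover k) (fun _ => readReg p x (.cur p) fun _ => .pre) ((I k).recAct l)
  | .pre => readReg p x (.cur p) fun _ => .run (A.start p x)
  | .run l => match A.act l with
    | .op k o cont =>
      .write (Reg.cur p) ⟨.cur p, some k⟩ (p, x, .busy k cont ((I k).start p o))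
    | .read r cont => readReg p x (.outer r) fun v => .run (cont v)
    | .write r v cont => .write (Reg.outer r) ⟨.outer r, v⟩ (p, x, .run cont)
    | .ret v => .ret v
  | .busy k cont l =>
    lift p x k (.busy k cont) (fun r => readReg p x (.cur p) fun _ => .run (cont r)) ((I k).act l)

/-- The algorithm `A`, with its objects replaced by the implementations `I`. -/
noncomputable abbrev algorithm : Algorithm T₁ n D where
  base := base A I
  Loc := Fin n × D × Loc A I
  start p x := (p, x, .boot)
  act l := act l.1 l.2.1 l.2.2

/-! ### A structured view of the executions -/

structure Config where
  mem : Mem A I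
  loc : Fin n → Option (Loc A I)

def Config.initial : Config A I where
  mem := .initial A I
  loc _ := some .boot

variable {A I} in
def Config.encode (c : Config A I) (input : Fin n → D) : (algorithm A I).Config where
  mem := c.mem.encode
  loc p := (c.loc p).map fun l => (p, input p, l)

/-- What happens in a transition of the composed algorithm. -/
inductive Label : Type
  | boot (p : Fin n)
  | recStep (p : Fin n) (k : A.base.Obj)
  | recovered (p : Fin n) (k : A.base.Obj)
  | pre (p : Fin n)
  | inv (p : Fin n) (k : A.base.Obj) (o : T₂.Op) (l : A.Loc) (cont : T₂.Resp → A.Loc)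
  | reg (p : Fin n) (l : A.Loc)
  | inner (p : Fin n) (k : A.base.Obj)
  | resp (p : Fin n) (k : A.base.Obj) (r : T₂.Resp) (l : A.Loc)
  | out (p : Fin n) (v : D)
  | crash (p : Fin n) (k : Option A.base.Obj)
  | pass

variable {A} in
def Label.event : Label A → Algorithm.Event n D
  | .boot p | .recStep p _ | .recovered p _ | .pre p | .inv p _ _ _ _ | .reg p _ | .inner p _
  | .resp p _ _ _ => .step p
  | .out p v => .out p v
  | .crash p _ => .crash p
  | .pass => .pass

open Classical in
variable {A I} in
noncomputable def Mem.setInner (m : Mem A I) (k : A.base.Obj) (m' : Memory (I k).base) : Mem A I :=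
  { m with inner := Function.update m.inner k m' }

variable {A I} in
def Config.setLoc (c : Config A I) (p : Fin n) (l : Option (Loc A I)) : Config A I :=
  { c with loc := Function.update c.loc p l }

open Classical in
variable {A I} in
inductive Step (input : Fin n → D) : Config A I → Label A → Config A I → Prop
  | boot_none (c : Config A I) (p : Fin n) (hp : c.loc p = some .boot) (hc : c.mem.cur p = none) :
      Step input c (.boot p) (c.setLoc p (some .pre))
  | boot_some (c : Config A I) (p : Fin n) (k : A.base.Obj) (hp : c.loc p = some .boot)
      (hc : c.mem.cur p = some k) :
      Step input c (.boot p) (c.setLoc p (some (.recover k ((I k).recStart p))))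
  | recStep (c : Config A I) (p : Fin n) (k : A.base.Obj) (l l' : (I k).RecLoc)
      (m : Memory (I k).base) (hp : c.loc p = some (.recover k l))
      (h : Access ((I k).recAct l) (c.mem.inner k) m l') :
      Step input c (.recStep p k)
        (Config.setLoc ⟨c.mem.setInner k m, c.loc⟩ p (some (.recover k l')))
  | recovered (c : Config A I) (p : Fin n) (k : A.base.Obj) (l : (I k).RecLoc)
      (hp : c.loc p = some (.recover k l)) (h : (I k).recAct l = .ret ()) :
      Step input c (.recovered p k) (c.setLoc p (some .pre))
  | pre (c : Config A I) (p : Fin n) (hp : c.loc p = some .pre) :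
      Step input c (.pre p) (c.setLoc p (some (.run (A.start p (input p)))))
  | inv (c : Config A I) (p : Fin n) (l : A.Loc) (k : A.base.Obj) (o : T₂.Op)
      (cont : T₂.Resp → A.Loc) (hp : c.loc p = some (.run l)) (h : A.act l = .op k o cont) :
      Step input c (.inv p k o l cont)
        (Config.setLoc ⟨{ c.mem with cur := Function.update c.mem.cur p (some k) }, c.loc⟩ p
          (some (.busy k cont ((I k).start p o))))
  | read (c : Config A I) (p : Fin n) (l : A.Loc) (r : A.base.Reg) (cont : A.base.Val → A.Loc)
      (hp : c.loc p = some (.run l)) (h : A.act l = .read r cont) :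
      Step input c (.reg p (cont (c.mem.outer r)))
        (c.setLoc p (some (.run (cont (c.mem.outer r)))))
  | write (c : Config A I) (p : Fin n) (l : A.Loc) (r : A.base.Reg) (v : A.base.Val) (l' : A.Loc)
      (hp : c.loc p = some (.run l)) (h : A.act l = .write r v l') :
      Step input c (.reg p l')
        (Config.setLoc ⟨{ c.mem with outer := Function.update c.mem.outer r v }, c.loc⟩ p
          (some (.run l')))
  | inner (c : Config A I) (p : Fin n) (k : A.base.Obj) (cont : T₂.Resp → A.Loc)
      (l l' : (I k).Loc) (m : Memory (I k).base) (hp : c.loc p = some (.busy k cont l))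
      (h : Access ((I k).act l) (c.mem.inner k) m l') :
      Step input c (.inner p k)
        (Config.setLoc ⟨c.mem.setInner k m, c.loc⟩ p (some (.busy k cont l')))
  | resp (c : Config A I) (p : Fin n) (k : A.base.Obj) (cont : T₂.Resp → A.Loc) (l : (I k).Loc)
      (r : T₂.Resp) (hp : c.loc p = some (.busy k cont l)) (h : (I k).act l = .ret r) :
      Step input c (.resp p k r (cont r)) (c.setLoc p (some (.run (cont r))))
  | out (c : Config A I) (p : Fin n) (l : A.Loc) (v : D) (hp : c.loc p = some (.run l))
      (h : A.act l = .ret v) :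
      Step input c (.out p v) (c.setLoc p none)
  -- The label keeps the content of `cur p`, which determines the only object that is to notice this
  -- crash.
  | crash (c : Config A I) (p : Fin n) :
      Step input c (.crash p (c.mem.cur p)) (c.setLoc p (some .boot))
  | pass (c : Config A I) : Step input c .pass c

/-- An execution of the composed algorithm. -/
structure Trace (input : Fin n → D) where
  cfg : ℕ → Config A I
  lab : ℕ → Label A
  init : cfg 0 = .initial A I
  next : ∀ t, Step input (cfg t) (lab t) (cfg (t + 1))

end Defs

variable {A : Algorithm T₂ n D} {I : A.base.Obj → Implementation T₁ T₂ n} {input : Fin n → D}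

/-! ### Executions of the composed algorithm as traces -/

theorem access_readReg {p : Fin n} {x : D} {r : Reg A I} {f : r.Val → Loc A I} {m : Mem A I}
    {M : Memory (base A I)} {l : Fin n × D × Loc A I}
    (h : Access (readReg p x r f) m.encode M l) : M = m.encode ∧ l = (p, x, f (m.get r)) := by
  unfold readReg at h
  cases h
  simp [Mem.encode]

theorem memory_ext {T : ObjType} {B : Base T} {m m' : Memory B} (h : m.obj = m'.obj)
    (h' : m.reg = m'.reg) : m = m' := by
  cases m; cases m'; cases h; cases h'; rfl

open Classical in
theorem encode_update_obj (m : Mem A I) (k : A.base.Obj) (y : (I k).base.Obj) (s : T₁.State) :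
    ({ m.encode with obj := Function.update m.encode.obj ⟨k, y⟩ s } : Memory (base A I)) =
      (m.setInner k { m.inner k with obj := Function.update (m.inner k).obj y s }).encode := by
  refine memory_ext ?_ ?_ <;> simp only [Mem.encode, Mem.setInner]
  · funext ⟨k', y'⟩
    by_cases hk : k' = k
    · subst hk
      by_cases hy : y' = y
      · subst hy; simp
      · have : (⟨k', y'⟩ : (base A I).Obj) ≠ ⟨k', y⟩ := fun h => hy (by simpa using h)
        rw [Function.update_of_ne this]; simp [Function.update_of_ne hy]
    · have : (⟨k', y'⟩ : (base A I).Obj) ≠ ⟨k, y⟩ := fun h => hk (congrArg Sigma.fst h)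
      rw [Function.update_of_ne this]; simp [Function.update_of_ne hk]
  · funext r
    cases r with
    | inner k' r =>
      by_cases hk : k' = k
      · subst hk; simp [Mem.get]
      · simp [Mem.get, Function.update_of_ne hk]
    | _ => rfl

open Classical in
theorem encode_update_inner (m : Mem A I) (k : A.base.Obj) (r : (I k).base.Reg)
    (v : (I k).base.Val) :
    ({ m.encode with reg := Function.update m.encode.reg (Reg.inner k r) ⟨.inner k r, v⟩ } :
      Memory (base A I)) =
      (m.setInner k { m.inner k with reg := Function.update (m.inner k).reg r v }).encode := by
  refine memory_ext ?_ ?_ <;> simp only [Mem.encode, Mem.setInner]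
  · funext ⟨k', y'⟩
    by_cases hk : k' = k
    · subst hk; simp
    · simp [Function.update_of_ne hk]
  · funext r'
    by_cases h : r' = .inner k r
    · subst h
      erw [Function.update_self]
      simp [Mem.get]
    · erw [Function.update_of_ne h]
      cases r' with
      | inner k' r' =>
        by_cases hk : k' = k
        · subst hk
          have : r' ≠ r := fun e => h (by rw [e])
          simp [Mem.get, Function.update_of_ne this]
        · simp [Mem.get, Function.update_of_ne hk]
      | _ => rfl

open Classical in
theorem encode_update_outer (m : Mem A I) (r : A.base.Reg) (v : A.base.Val) :
    ({ m.encode with reg := Function.update m.encode.reg (Reg.outer r) ⟨.outer r, v⟩ } :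
      Memory (base A I)) =
      ({ m with outer := Function.update m.outer r v } : Mem A I).encode := by
  refine memory_ext rfl ?_
  simp only [Mem.encode]
  funext r'
  by_cases h : r' = .outer r
  · subst h
    erw [Function.update_self]
    simp [Mem.get]
  · erw [Function.update_of_ne h]
    cases r' with
    | outer r' =>
      have : r' ≠ r := fun e => h (by rw [e])
      simp [Mem.get, Function.update_of_ne this]
    | _ => rfl

open Classical in
theorem encode_update_cur (m : Mem A I) (p : Fin n) (v : Option A.base.Obj) :
    ({ m.encode with reg := Function.update m.encode.reg (Reg.cur p) ⟨.cur p, v⟩ } :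
      Memory (base A I)) =
      ({ m with cur := Function.update m.cur p v } : Mem A I).encode := by
  refine memory_ext rfl ?_
  simp only [Mem.encode]
  funext r'
  by_cases h : r' = .cur p
  · subst h
    erw [Function.update_self]
    simp [Mem.get]
  · erw [Function.update_of_ne h]
    cases r' with
    | cur p' =>
      have : p' ≠ p := fun e => h (by rw [e])
      simp [Mem.get, Function.update_of_ne this]
    | _ => rfl

/-- The second alternative arises because a return is no memory access of the implementation, while
the dummy read that replaces it is one. -/
theorem access_lift {L Out : Type} {p : Fin n} {x : D} {k : A.base.Obj} {f : L → Loc A I}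
    {onRet : Out → Action (base A I) (Fin n × D × Loc A I) D} {a : Action (I k).base L Out}
    {m : Mem A I} {M : Memory (base A I)} {l : Fin n × D × Loc A I}
    (h : Access (lift p x k f onRet a) m.encode M l) :
    (∃ m' l', Access a (m.inner k) m' l' ∧ M = (m.setInner k m').encode ∧ l = (p, x, f l')) ∨
      ∃ v, a = .ret v ∧ Access (onRet v) m.encode M l := by
  cases a with
  | op y o cont =>
    left
    unfold lift at h
    cases h with
    | op _ _ _ _ r s h =>
      exact ⟨_, _, .op _ y o cont r s h, by convert encode_update_obj m k y s, rfl⟩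
  | read r cont =>
    left
    unfold lift at h
    obtain ⟨rfl, rfl⟩ := access_readReg h
    refine ⟨_, _, .read _ r cont, ?_, rfl⟩
    simp [Mem.setInner]
  | write r v cont =>
    left
    unfold lift at h
    cases h
    exact ⟨_, _, .write _ r v cont, encode_update_inner m k r v, rfl⟩
  | ret v => exact .inr ⟨v, rfl, h⟩

theorem encode_setLoc (c : Config A I) (p : Fin n) (l : Option (Loc A I)) (m : Mem A I) :
    (Config.setLoc ⟨m, c.loc⟩ p l).encode input =
      ⟨m.encode, Function.update (c.encode input).loc p (l.map fun l => (p, input p, l))⟩ := by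
  unfold Config.encode Config.setLoc
  congr 1
  funext q
  by_cases h : q = p
  · subst h; simp
  · simp [Function.update_of_ne h]

/-- Encoded configurations are closed under transitions, since every write stores a correctly tagged
value and every local state carries its own process and input. -/
theorem exists_step {c : Config A I} {e : Algorithm.Event n D} {C : (algorithm A I).Config}
    (h : (algorithm A I).Step input (c.encode input) e C) :
    ∃ lab c', Step input c lab c' ∧ c'.encode input = C ∧ e = lab.event := by
  cases h with
  | step p L L' M hL h =>
    obtain ⟨l, hp, rfl⟩ : ∃ l, c.loc p = some l ∧ (p, input p, l) = L :=
      Option.map_eq_some_iff.1 hL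
    replace h : Access (act p (input p) l) c.mem.encode M L' := h
    cases l with
    | boot =>
      unfold act at h
      obtain ⟨rfl, rfl⟩ := access_readReg h
      cases hc : c.mem.cur p with
      | none =>
        refine ⟨_, _, .boot_none c p hp hc, ?_, rfl⟩
        erw [encode_setLoc c]
        simp [Mem.get, hc]
      | some k =>
        refine ⟨_, _, .boot_some c p k hp hc, ?_, rfl⟩
        erw [encode_setLoc c]
        simp [Mem.get, hc]
    | recover k l =>
      rcases access_lift h with ⟨m', l', ha, rfl, rfl⟩ | ⟨v, hv, ha⟩
      · exact ⟨_, _, .recStep c p k l l' m' hp ha, encode_setLoc c .., rfl⟩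
      · obtain ⟨rfl, rfl⟩ := access_readReg ha
        exact ⟨_, _, .recovered c p k l hp hv, encode_setLoc c .., rfl⟩
    | pre =>
      unfold act at h
      obtain ⟨rfl, rfl⟩ := access_readReg h
      exact ⟨_, _, .pre c p hp, encode_setLoc c .., rfl⟩
    | run l =>
      unfold act at h
      cases hl : A.act l with
      | op k o cont =>
        simp only [hl] at h
        cases h
        refine ⟨_, _, .inv c p l k o cont hp hl, ?_, rfl⟩
        erw [encode_setLoc c, encode_update_cur]
        rfl
      | read r cont =>
        simp only [hl] at h
        obtain ⟨rfl, rfl⟩ := access_readReg h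
        exact ⟨_, _, .read c p l r cont hp hl, encode_setLoc c .., rfl⟩
      | write r v l' =>
        simp only [hl] at h
        cases h
        refine ⟨_, _, .write c p l r v l' hp hl, ?_, rfl⟩
        erw [encode_setLoc c, encode_update_outer]
        rfl
      | ret v =>
        simp only [hl] at h
        cases h
    | busy k cont l =>
      rcases access_lift h with ⟨m', l', ha, rfl, rfl⟩ | ⟨r, hr, ha⟩
      · exact ⟨_, _, .inner c p k cont l l' m' hp ha, encode_setLoc c .., rfl⟩
      · obtain ⟨rfl, rfl⟩ := access_readReg ha
        exact ⟨_, _, .resp c p k cont l r hp hr, encode_setLoc c .., rfl⟩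
  | out p L v hL h =>
    obtain ⟨l, hp, rfl⟩ : ∃ l, c.loc p = some l ∧ (p, input p, l) = L :=
      Option.map_eq_some_iff.1 hL
    replace h : act p (input p) l = .ret v := h
    cases l with
    | run l =>
      unfold act at h
      cases hl : A.act l <;> simp [hl, readReg] at h
      subst h
      exact ⟨_, _, .out c p l _ hp hl, encode_setLoc c .., rfl⟩
    | recover k l =>
      unfold act at h
      cases hl : (I k).recAct l <;> simp [hl, readReg, lift] at h
    | busy k cont l =>
      unfold act at h
      cases hl : (I k).act l <;> simp [hl, readReg, lift] at h
    | _ => simp [act, readReg] at h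
  | crash p => exact ⟨_, _, .crash c p, encode_setLoc c .., rfl⟩
  | pass => exact ⟨_, _, .pass c, rfl, rfl⟩

theorem exists_trace (E : (algorithm A I).Execution input) :
    ∃ S : Trace A I input, ∀ t, E.ev t = (S.lab t).event := by
  obtain ⟨f, h₀, hf⟩ := exists_seq_of_step (fun t (c : Config A I) => c.encode input = E.cfg t)
    (fun t c c' => ∃ lab, Step input c lab c' ∧ E.ev t = lab.event) (.initial A I)
    (E.init ▸ rfl) (fun t c hc => by
      have h := E.next t
      rw [← hc] at h
      obtain ⟨lab, c', h₁, h₂, h₃⟩ := exists_step h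
      exact ⟨c', h₂, lab, h₁, h₃⟩)
  choose hf lab h₁ h₂ using hf
  exact ⟨⟨f, lab, h₀, h₁⟩, h₂⟩

/-! ### The executions of the individual implementations -/

/-- The object whose implementation is being executed. -/
def Loc.obj : Option (Loc A I) → Option A.base.Obj
  | some (.recover k _) => some k
  | some (.busy k _ _) => some k
  | _ => none

/-- This invariant is what makes it safe to hide crashes: a process is idle on every object other
than the one in `cur p`. -/
def Config.Consistent (c : Config A I) : Prop :=
  ∀ p k, Loc.obj (c.loc p) = some k → c.mem.cur p = some k

theorem Step.consistent {c c' : Config A I} {lab : Label A} (h : Step input c lab c')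
    (hc : c.Consistent) : c'.Consistent := by
  have key : ∀ (m : Mem A I) (p : Fin n) (l : Option (Loc A I)),
      (∀ q, q ≠ p → m.cur q = c.mem.cur q) → (∀ k, Loc.obj l = some k → m.cur p = some k) →
      (Config.setLoc ⟨m, c.loc⟩ p l).Consistent := by
    intro m p l h₁ h₂ q k hq
    by_cases hqp : q = p
    · subst hqp
      simp only [Config.setLoc, Function.update_self] at hq ⊢
      exact h₂ k hq
    · simp only [Config.setLoc, Function.update_of_ne hqp] at hq ⊢
      rw [h₁ q hqp]
      exact hc q k hq
  cases h with
  | boot_none | recovered | pre | read | resp | out | crash | write =>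
    exact key _ _ _ (fun _ _ => rfl) (fun k hk => by simp [Loc.obj] at hk)
  | boot_some p k hp hcur =>
    exact key _ _ _ (fun _ _ => rfl) (fun k' hk => by rw [hcur]; exact hk)
  | recStep p k l l' m hp h =>
    exact key _ _ _ (fun _ _ => rfl) (fun k' hk => hc p k' (by rw [hp]; exact hk))
  | inner p k cont l l' m hp h =>
    exact key _ _ _ (fun _ _ => rfl) (fun k' hk => hc p k' (by rw [hp]; exact hk))
  | inv p l k o cont hp h =>
    exact key _ _ _ (fun q hq => by simp [Function.update_of_ne hq])
      (fun k' hk => by simpa [Loc.obj] using hk)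
  | pass => exact hc

open Classical in
/-- What a process is doing on the object `k`. -/
noncomputable def Loc.status (k : A.base.Obj) (cur : Option A.base.Obj) (p : Fin n) :
    Option (Loc A I) → (I k).Status
  | some .boot => if cur = some k then .recovering ((I k).recStart p) else .idle
  | some (.recover k' l) => if h : k' = k then .recovering (h ▸ l) else .idle
  | some (.busy k' _ l) => if h : k' = k then .busy (h ▸ l) else .idle
  | _ => .idle

noncomputable def Config.project (c : Config A I) (k : A.base.Obj) : (I k).Config where
  mem := c.mem.inner k
  status p := Loc.status k (c.mem.cur p) p (c.loc p)

open Classical in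
/-- The event on the object `k`. A crash of a process that has not used `k` last goes unnoticed. -/
noncomputable def Label.project (k : A.base.Obj) : Label A → Implementation.Event T₂ n
  | .recStep p k' => if k' = k then .step p else .pass
  | .recovered p k' => if k' = k then .recovered p else .pass
  | .pre p => .other p
  | .inv p k' o _ _ => if k' = k then .inv p o else .pass
  | .inner p k' => if k' = k then .step p else .pass
  | .resp p k' r _ => if k' = k then .resp p r else .pass
  | .crash p k' => if k' = some k then .crash p else .pass
  | _ => .pass

theorem project_setLoc (c : Config A I) (m : Mem A I) (p : Fin n) (l : Option (Loc A I))
    (k : A.base.Obj) (M : Memory (I k).base) (s : (I k).Status) (hM : m.inner k = M)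
    (hs : Loc.status k (m.cur p) p l = s) (hcur : ∀ q, q ≠ p → m.cur q = c.mem.cur q) :
    (Config.setLoc ⟨m, c.loc⟩ p l).project k =
      ⟨M, Function.update (c.project k).status p s⟩ := by
  subst hM hs
  unfold Config.project Config.setLoc
  congr 1
  funext q
  by_cases h : q = p
  · subst h; simp
  · simp [Function.update_of_ne h, hcur q h]

theorem project_setLoc_of_eq (c : Config A I) (m : Mem A I) (p : Fin n) (l : Option (Loc A I))
    (k : A.base.Obj) (hM : m.inner k = c.mem.inner k)
    (hs : Loc.status k (m.cur p) p l = Loc.status k (c.mem.cur p) p (c.loc p))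
    (hcur : ∀ q, q ≠ p → m.cur q = c.mem.cur q) :
    (Config.setLoc ⟨m, c.loc⟩ p l).project k = c.project k := by
  rw [project_setLoc c m p l k _ _ hM hs hcur]
  unfold Config.project
  simp

open Classical in
-- Steps that do not concern `k` become `pass`, except `pre`, which every object sees as `other`.
theorem Step.project {c c' : Config A I} {lab : Label A} (h : Step input c lab c')
    (hc : c.Consistent) (k : A.base.Obj) :
    (I k).Step (c.project k) (lab.project k) (c'.project k) := by
  cases h with
  | boot_none p hp hcur =>
    erw [project_setLoc_of_eq c c.mem p _ k rfl (by simp [Loc.status, hp, hcur]) (fun _ _ => rfl)]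
    exact .pass _
  | boot_some p k' hp hcur =>
    -- A process in `boot` already counts as recovering on the object in `cur p`, so looking that
    -- object up changes no status.
    erw [project_setLoc_of_eq c c.mem p _ k rfl ?_ (fun _ _ => rfl)]
    · exact .pass _
    · by_cases hk : k' = k
      · subst hk; simp [Loc.status, hp, hcur]
      · simp [Loc.status, hp, hcur, hk]
  | recStep p k' l l' m hp h =>
    by_cases hk : k' = k
    · subst hk
      rw [project_setLoc c
        (c.mem.setInner k' m) p _ k' m (.recovering l') (by simp [Mem.setInner])
        (by simp [Loc.status]) (fun _ _ => rfl)]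
      simp only [Label.project, if_true]
      exact .recStep _ p l l' m (by simp [Config.project, hp, Loc.status]) h
    · rw [project_setLoc_of_eq c
        (c.mem.setInner k' m) p _ k
        (by simp [Mem.setInner, Function.update_of_ne (Ne.symm hk)])
        (by simp [Loc.status, hp, hk]) (fun _ _ => rfl)]
      simp only [Label.project, if_neg hk]
      exact .pass _
  | recovered p k' l hp h =>
    by_cases hk : k' = k
    · subst hk
      erw [project_setLoc c c.mem p _ k' _ .idle rfl (by simp [Loc.status]) (fun _ _ => rfl)]
      simp only [Label.project, if_true]
      exact .recovered _ p l (by simp [Config.project, hp, Loc.status]) h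
    · erw [project_setLoc_of_eq c c.mem p _ k rfl (by simp [Loc.status, hp, hk]) (fun _ _ => rfl)]
      simp only [Label.project, if_neg hk]
      exact .pass _
  | pre p hp =>
    erw [project_setLoc_of_eq c c.mem p _ k rfl (by simp [Loc.status, hp]) (fun _ _ => rfl)]
    exact .other _ p (by simp [Config.project, hp, Loc.status])
  | inv p l k' o cont hp h =>
    by_cases hk : k' = k
    · subst hk
      rw [project_setLoc c
        { c.mem with cur := Function.update c.mem.cur p (some k') } p _ k' (c.mem.inner k') (.busy ((I k').start p o)) rfl
        (by simp [Loc.status]) (fun q hq => by simp [Function.update_of_ne hq])]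
      simp only [Label.project, if_true]
      exact .inv _ p o (by simp [Config.project, hp, Loc.status])
    · rw [project_setLoc_of_eq c
        { c.mem with cur := Function.update c.mem.cur p (some k') } p _ k rfl (by simp [Loc.status, hp, hk])
        (fun q hq => by simp [Function.update_of_ne hq])]
      simp only [Label.project, if_neg hk]
      exact .pass _
  | read p l r cont hp h =>
    erw [project_setLoc_of_eq c c.mem p _ k rfl (by simp [Loc.status, hp]) (fun _ _ => rfl)]
    exact .pass _
  | write p l r v l' hp h =>
    rw [project_setLoc_of_eq c
        { c.mem with outer := Function.update c.mem.outer r v } p _ k rfl (by simp [Loc.status, hp]) (fun _ _ => rfl)]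
    exact .pass _
  | inner p k' cont l l' m hp h =>
    by_cases hk : k' = k
    · subst hk
      rw [project_setLoc c
        (c.mem.setInner k' m) p _ k' m (.busy l') (by simp [Mem.setInner])
        (by simp [Loc.status]) (fun _ _ => rfl)]
      simp only [Label.project, if_true]
      exact .step _ p l l' m (by simp [Config.project, hp, Loc.status]) h
    · rw [project_setLoc_of_eq c
        (c.mem.setInner k' m) p _ k
        (by simp [Mem.setInner, Function.update_of_ne (Ne.symm hk)])
        (by simp [Loc.status, hp, hk]) (fun _ _ => rfl)]
      simp only [Label.project, if_neg hk]
      exact .pass _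
  | resp p k' cont l r hp h =>
    by_cases hk : k' = k
    · subst hk
      erw [project_setLoc c c.mem p _ k' _ .idle rfl (by simp [Loc.status]) (fun _ _ => rfl)]
      simp only [Label.project, if_true]
      exact .resp _ p l r (by simp [Config.project, hp, Loc.status]) h
    · erw [project_setLoc_of_eq c c.mem p _ k rfl (by simp [Loc.status, hp, hk]) (fun _ _ => rfl)]
      simp only [Label.project, if_neg hk]
      exact .pass _
  | out p l v hp h =>
    erw [project_setLoc_of_eq c c.mem p _ k rfl (by simp [Loc.status, hp]) (fun _ _ => rfl)]
    exact .pass _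
  | crash p =>
    by_cases hk : c.mem.cur p = some k
    · erw [project_setLoc c c.mem p _ k _ (.recovering ((I k).recStart p)) rfl
        (by simp [Loc.status, hk]) (fun _ _ => rfl)]
      simp only [Label.project, if_pos hk]
      exact .crash _ p
    · erw [project_setLoc_of_eq c c.mem p _ k rfl ?_ (fun _ _ => rfl)]
      · simp only [Label.project, if_neg hk]
        exact .pass _
      -- By consistency the process was idle on `k` before the crash, and it is idle on `k` in
      -- `boot`.
      · have h := hc p k
        cases hl : c.loc p with
        | none => simp [Loc.status, hk]
        | some l =>
          rw [hl] at h
          cases l with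
          | recover k' l =>
            have : k' ≠ k := fun e => hk (h (congrArg some e))
            simp [Loc.status, hk, this]
          | busy k' cont l =>
            have : k' ≠ k := fun e => hk (h (congrArg some e))
            simp [Loc.status, hk, this]
          | _ => simp [Loc.status, hk]
  | pass => exact .pass _

theorem Trace.consistent (S : Trace A I input) (t : ℕ) : (S.cfg t).Consistent := by
  induction t with
  | zero => rw [S.init]; intro p k h; simp [Config.initial, Loc.obj] at h
  | succ t ih => exact (S.next t).consistent ih

/-- The execution of the implementation of the object `k`. -/
noncomputable def Trace.project (S : Trace A I input) (k : A.base.Obj) : (I k).Execution where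
  cfg t := (S.cfg t).project k
  ev t := (S.lab t).project k
  init := by
    rw [S.init]
    simp [Config.project, Config.initial, Implementation.initial, Mem.initial, Loc.status]
  next t := (S.next t).project (S.consistent t) k

end Composition

/-! ### Concatenating finite paths -/

/-- A finite sequence of labelled transitions. -/
inductive Path {C E : Type*} (R : C → E → C → Prop) : C → List E → C → Prop
  | nil (c : C) : Path R c [] c
  | cons {c d e : C} {x : E} {w : List E} (h : R c x d) (hw : Path R d w e) : Path R c (x :: w) e

namespace Path

variable {C E : Type*} {R : C → E → C → Prop}

theorem append {c d e : C} {v w : List E} (h : Path R c v d) (h' : Path R d w e) :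
    Path R c (v ++ w) e := by
  induction h with
  | nil => exact h'
  | cons hx _ ih => exact .cons hx (ih h')

theorem exists_seq {c d : C} {w : List E} (h : Path R c w d) :
    ∃ f : ℕ → C, f 0 = c ∧ f w.length = d ∧
      ∀ (j : ℕ) (hj : j < w.length), R (f j) w[j] (f (j + 1)) := by
  induction h with
  | nil c => exact ⟨fun _ => c, rfl, rfl, fun j hj => absurd hj (by simp)⟩
  | @cons c d e x w hx _ ih =>
    obtain ⟨f, h₀, h₁, hf⟩ := ih
    refine ⟨fun j => Nat.casesOn j c f, rfl, h₁, fun j hj => ?_⟩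
    cases j with
    | zero => simpa [h₀] using hx
    | succ j => exact hf j (by simpa using hj)

/-- Infinitely many nonempty paths can be concatenated; `τ t` is the time when the path with
number `t` starts. -/
theorem exists_concat {c : ℕ → C} {w : ℕ → List E} (h : ∀ t, Path R (c t) (w t) (c (t + 1)))
    (hw : ∀ t, w t ≠ []) :
    ∃ (cfg : ℕ → C) (ev : ℕ → E) (τ : ℕ → ℕ), cfg 0 = c 0 ∧
      (∀ s, R (cfg s) (ev s) (cfg (s + 1))) ∧ StrictMono τ ∧
      (∀ t, ∀ x ∈ w t, ∃ s, τ t ≤ s ∧ ev s = x) ∧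
      ∀ s, ∃ t, s < τ (t + 1) ∧ ev s ∈ w t := by
  choose f hf₀ hf₁ hf using fun t => (h t).exists_seq
  have hlen : ∀ t, 0 < (w t).length := fun t => List.length_pos_of_ne_nil (hw t)
  let τ : ℕ → ℕ := fun t => ∑ i ∈ Finset.range t, (w i).length
  have hτ : ∀ t, τ (t + 1) = τ t + (w t).length := fun t => Finset.sum_range_succ _ _
  have hmono : StrictMono τ := strictMono_nat_of_lt_succ fun t => by
    have := hlen t
    rw [hτ]; omega
  have hex : ∀ s, ∃ t, τ t ≤ s ∧ s < τ (t + 1) := by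
    intro s
    induction s with
    | zero => exact ⟨0, le_rfl, by rw [hτ]; have := hlen 0; simp [τ]; omega⟩
    | succ s ih =>
      obtain ⟨t, h₁, h₂⟩ := ih
      by_cases hs : s + 1 < τ (t + 1)
      · exact ⟨t, by omega, hs⟩
      · exact ⟨t + 1, by omega, by have := hmono (Nat.lt_add_one (t + 1)); omega⟩
  -- `T s` is the number of the path to which time `s` belongs.
  choose T hT₁ hT₂ using hex
  have huniq : ∀ s t, τ t ≤ s → s < τ (t + 1) → T s = t := by
    intro s t h₁ h₂
    have a := hmono.lt_iff_lt.1 ((hT₁ s).trans_lt h₂)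
    have b := hmono.lt_iff_lt.1 (h₁.trans_lt (hT₂ s))
    omega
  have hlt : ∀ s, s - τ (T s) < (w (T s)).length := fun s => by
    have h₁ := hT₁ s
    have h₂ := hT₂ s
    rw [hτ] at h₂
    omega
  refine ⟨fun s => f (T s) (s - τ (T s)), fun s => (w (T s))[s - τ (T s)]'(hlt s), τ, ?_, ?_,
    hmono, ?_, ?_⟩
  · have : T 0 = 0 := huniq 0 0 le_rfl (by rw [hτ]; have := hlen 0; omega)
    simp [this, hf₀]
  · intro s
    have hs := hf (T s) _ (hlt s)
    have h₁ := hT₁ s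
    have h₂ := hT₂ s
    by_cases h' : s + 1 < τ (T s + 1)
    · have e : T (s + 1) = T s := huniq _ _ (by omega) h'
      have : s + 1 - τ (T s) = s - τ (T s) + 1 := by omega
      simp only [e, this]
      exact hs
    -- Here `s` is the last time of its path, and the end point of this path is the start of the
    -- next one.
    · have h₃ := hτ (T s)
      have e : T (s + 1) = T s + 1 :=
        huniq _ _ (by omega) (by have := hmono (Nat.lt_add_one (T s + 1)); omega)
      have e₁ : s + 1 - τ (T s + 1) = 0 := by omega
      have e₂ : s - τ (T s) + 1 = (w (T s)).length := by omega
      simp only [e, e₁, hf₀]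
      rwa [e₂, hf₁] at hs
  · intro t x hx
    obtain ⟨j, hj, rfl⟩ := List.getElem_of_mem hx
    have e : T (τ t + j) = t := huniq _ _ (by omega) (by rw [hτ]; omega)
    refine ⟨τ t + j, by omega, ?_⟩
    simp [e]
  · intro s
    exact ⟨T s, hT₂ s, List.getElem_mem _⟩

end Path

namespace Composition

variable {T₁ T₂ : ObjType} {n : ℕ} {D : Type}
variable {A : Algorithm T₂ n D} {I : A.base.Obj → Implementation T₁ T₂ n} {input : Fin n → D}

/-! ### Pending operations -/

variable (A) in
/-- The state of a process in the simulated execution of `A`: a local state, or an operation on `k`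
invoked at time `i` in the local state `l`, to be continued by `cont` after it takes effect. -/
inductive Ghost : Type
  | plain (l : Option A.Loc)
  | pend (i : ℕ) (k : A.base.Obj) (l : A.Loc) (cont : T₂.Resp → A.Loc)

/-- Crashes, `boot` and recovery steps leave the ghost state alone; the old run is given up only at
`pre`. Thus an operation interrupted by a crash stays pending during recovery. -/
def Ghost.next (input : Fin n → D) (t : ℕ) (g : Fin n → Ghost A) : Label A → Fin n → Ghost A
  | .pre p => Function.update g p (.plain (some (A.start p (input p))))
  | .inv p k _ l cont => Function.update g p (.pend t k l cont)
  | .reg p l => Function.update g p (.plain (some l))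
  | .resp p _ _ l => Function.update g p (.plain (some l))
  | .out p _ => Function.update g p (.plain none)
  | _ => g

def Trace.ghost (S : Trace A I input) : ℕ → Fin n → Ghost A
  | 0 => fun p => .plain (some (A.start p (input p)))
  | t + 1 => Ghost.next input t (S.ghost t) (S.lab t)

/-- Nothing is required between a crash and `pre`, when the ghost still belongs to the interrupted
run. -/
def Ghost.Matches (g : Ghost A) : Option (Loc A I) → Prop
  | none => g = .plain none
  | some (.run l) => g = .plain (some l)
  | some (.busy k cont _) => ∃ i l, g = .pend i k l cont
  | _ => True

theorem Step.matches {c c' : Config A I} {lab : Label A} (h : Step input c lab c')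
    {g : Fin n → Ghost A} (hg : ∀ p, (g p).Matches (c.loc p)) (t : ℕ) (q : Fin n) :
    (Ghost.next input t g lab q).Matches (c'.loc q) := by
  have hq := hg q
  cases h with
  | inner p k cont l l' m hp h =>
    by_cases hqp : q = p
    · subst hqp
      rw [hp] at hq
      simpa [Ghost.next, Config.setLoc, Ghost.Matches] using hq
    · simpa [Ghost.next, Config.setLoc, Function.update_of_ne hqp] using hq
  | pass => exact hq
  | boot_none p | boot_some p | recStep p | recovered p | pre p | inv p | read p | write p | resp p
  | out p | crash p =>
    by_cases hqp : q = p
    · subst hqp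
      simp [Ghost.next, Config.setLoc, Ghost.Matches]
    · simpa [Ghost.next, Config.setLoc, Function.update_of_ne hqp] using hq

theorem Trace.matches (S : Trace A I input) (t : ℕ) :
    ∀ p, (S.ghost t p).Matches ((S.cfg t).loc p) := by
  induction t with
  | zero => intro p; simp [S.init, Config.initial, Ghost.Matches]
  | succ t ih => exact (S.next t).matches ih t

theorem Ghost.of_next_eq_pend {t : ℕ} {g : Fin n → Ghost A} {lab : Label A} {p : Fin n} {i : ℕ}
    {k : A.base.Obj} {l : A.Loc} {cont : T₂.Resp → A.Loc}
    (h : Ghost.next input t g lab p = .pend i k l cont) :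
    (∃ o, lab = .inv p k o l cont ∧ i = t) ∨
      (g p = .pend i k l cont ∧ ∀ k' o l' cont', lab ≠ .inv p k' o l' cont') := by
  cases lab with
  | inv q k' o l' cont' =>
    by_cases hpq : p = q
    · subst hpq
      simp only [Ghost.next, Function.update_self, Ghost.pend.injEq] at h
      obtain ⟨rfl, rfl, rfl, rfl⟩ := h
      exact .inl ⟨o, rfl, rfl⟩
    · simp only [Ghost.next, Function.update_of_ne hpq] at h
      exact .inr ⟨h, fun _ _ _ _ e => hpq (by cases e; rfl)⟩
  | pre q | reg q | resp q | out q =>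
    by_cases hpq : p = q
    · subst hpq
      simp [Ghost.next] at h
    · simp only [Ghost.next, Function.update_of_ne hpq] at h
      exact .inr ⟨h, by simp⟩
  | _ => exact .inr ⟨h, by simp⟩

theorem Step.act_of_inv {c c' : Config A I} {p : Fin n} {k : A.base.Obj} {o : T₂.Op} {l : A.Loc}
    {cont : T₂.Resp → A.Loc} (h : Step input c (.inv p k o l cont) c') :
    A.act l = .op k o cont := by
  cases h with
  | inv _ _ _ _ _ hp h => exact h

/-- A pending operation is the last one that the process has invoked. -/
theorem Trace.of_ghost_eq_pend (S : Trace A I input) {t i : ℕ} {p : Fin n} {k : A.base.Obj}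
    {l : A.Loc} {cont : T₂.Resp → A.Loc} (h : S.ghost t p = .pend i k l cont) :
    i < t ∧ (∃ o, S.lab i = .inv p k o l cont ∧ A.act l = .op k o cont) ∧
      ∀ j, i < j → j < t → ∀ k' o l' cont', S.lab j ≠ .inv p k' o l' cont' := by
  induction t with
  | zero => simp [Trace.ghost] at h
  | succ t ih =>
    rcases Ghost.of_next_eq_pend h with ⟨o, ho, rfl⟩ | ⟨h', hne⟩
    · refine ⟨Nat.lt_succ_self _, ⟨o, ho, ?_⟩, fun j _ _ => by omega⟩
      have := S.next i
      rw [ho] at this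
      exact this.act_of_inv
    · obtain ⟨h₁, h₂, h₃⟩ := ih h'
      refine ⟨by omega, h₂, fun j hj hj' => ?_⟩
      rcases Nat.lt_succ_iff_lt_or_eq.1 hj' with hj' | rfl
      · exact h₃ j hj hj'
      · exact hne

/-- The other labels that alter the ghost of `p` need `p` to be in a `run` state, where `Matches`
excludes a pending operation. -/
theorem Step.next_ghost_eq_pend {c c' : Config A I} {lab : Label A} (h : Step input c lab c')
    {g : Fin n → Ghost A} {t i : ℕ} {p : Fin n} {k : A.base.Obj} {l : A.Loc}
    {cont : T₂.Resp → A.Loc} (hm : (g p).Matches (c.loc p)) (hg : g p = .pend i k l cont)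
    (h_pre : lab ≠ .pre p) (h_resp : ∀ r l', lab ≠ .resp p k r l') :
    Ghost.next input t g lab p = .pend i k l cont := by
  rw [hg] at hm
  cases h with
  | boot_none | boot_some | recStep | recovered | inner | crash | pass => exact hg
  | pre q hq =>
    have : p ≠ q := fun e => h_pre (by rw [e])
    simpa [Ghost.next, Function.update_of_ne this] using hg
  | inv q _ _ _ _ hq | read q _ _ _ hq | write q _ _ _ _ hq | out q _ _ hq =>
    have : p ≠ q := fun e => by
      subst e
      rw [hq] at hm
      simp [Ghost.Matches] at hm
    simpa [Ghost.next, Function.update_of_ne this] using hg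
  | resp q k' cont' _ r hq =>
    have : p ≠ q := fun e => by
      subst e
      rw [hq] at hm
      obtain ⟨i', l', e⟩ := hm
      cases e
      exact h_resp _ _ rfl
    simpa [Ghost.next, Function.update_of_ne this] using hg

theorem Label.of_project_eq_inv {lab : Label A} {k : A.base.Obj} {p : Fin n} {o : T₂.Op}
    (h : lab.project k = .inv p o) : ∃ l cont, lab = .inv p k o l cont := by
  cases lab with
  | inv q k' o' l cont =>
    simp only [Label.project] at h
    split_ifs at h with hk
    cases h; subst hk
    exact ⟨l, cont, rfl⟩
  | _ =>
    simp only [Label.project, reduceCtorEq] at h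
    try split_ifs at h

theorem Trace.returns (S : Trace A I input) {t i : ℕ} {p : Fin n} {k : A.base.Obj}
    {l l' : A.Loc} {cont : T₂.Resp → A.Loc} {r : T₂.Resp} (h : S.ghost t p = .pend i k l cont)
    (hr : S.lab t = .resp p k r l') : (S.project k).Returns p i t r := by
  obtain ⟨h₁, ⟨o, ho, _⟩, h₂⟩ := S.of_ghost_eq_pend h
  refine ⟨h₁, ⟨o, ?_⟩, ?_, fun j hj hj' o' e => ?_⟩
  · simp [Trace.project, ho, Label.project]
  · simp [Trace.project, hr, Label.project]
  · obtain ⟨l, cont, e⟩ := Label.of_project_eq_inv (lab := S.lab j) e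
    exact h₂ j hj hj' _ _ _ _ e

/-- This is where persistence is used. Between invocation and linearization neither of the two
events that end the pending state can occur, so the simulated process is still waiting for this
operation when it takes effect. -/
theorem Trace.ghost_eq_pend_of_mem_lin (S : Trace A I input) {k : A.base.Obj} {q₀ : T₂.State}
    (L : Implementation.PersistentLinearization (S.project k) q₀) {t i : ℕ} {r : T₂.Resp}
    (hi : (i, r) ∈ L.lin t) {p : Fin n} {o : T₂.Op} (ho : (S.project k).ev i = .inv p o) :
    ∃ l cont, S.ghost t p = .pend i k l cont ∧ A.act l = .op k o cont := by
  obtain ⟨l, cont, hlab⟩ := Label.of_project_eq_inv (lab := S.lab i) ho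
  refine ⟨l, cont, ?_, ?_⟩
  · have hit := L.after_inv i r t hi
    suffices ∀ u, i + 1 ≤ u → u ≤ t → S.ghost u p = .pend i k l cont from this t hit le_rfl
    intro u hu
    induction u, hu using Nat.le_induction with
    | base => intro _; simp [Trace.ghost, hlab, Ghost.next]
    | succ u hu ih =>
      intro hut
      have hg := ih (by omega)
      refine (S.next u).next_ghost_eq_pend (S.matches u p) hg (fun e => ?_) (fun r' l' e => ?_)
      -- A `pre` of `p` would be an operation on another object before the linearization point.
      · exact (L.before_next i r t p o hi ho u hu (by omega)).1
          (by simp [Trace.project, e, Label.project])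
      -- A response at `u < t` would force a linearization point at most `u`, against uniqueness.
      · obtain ⟨t', ht', hr'⟩ := L.before_resp p i u r' (S.returns hg e)
        have := L.unique i r r' t t' hi hr'
        omega
  · have := S.next i
    rw [hlab] at this
    exact this.act_of_inv

/-! ### The simulated execution -/

open Classical in
/-- The local state of a process, when the operations in `R` have taken effect. -/
noncomputable def Ghost.eval (R : A.base.Obj → ℕ → T₂.Resp → Prop) : Ghost A → Option A.Loc
  | .plain l => l
  | .pend i k l cont => if h : ∃ r, R k i r then some (cont h.choose) else some l

noncomputable def Trace.simulated (S : Trace A I input) (t : ℕ) (st : A.base.Obj → T₂.State)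
    (R : A.base.Obj → ℕ → T₂.Resp → Prop) : A.Config where
  mem := ⟨st, (S.cfg t).mem.outer⟩
  loc p := (S.ghost t p).eval R

open Classical in
-- Letting one pending operation take effect is an atomic step of `A`. Only the invoking process
-- moves, because an invocation time determines its process.
theorem Trace.step_simulated (S : Trace A I input) {t i : ℕ} {st : A.base.Obj → T₂.State}
    {R : A.base.Obj → ℕ → T₂.Resp → Prop} {p : Fin n} {k : A.base.Obj} {l : A.Loc}
    {cont : T₂.Resp → A.Loc} {o : T₂.Op} {r : T₂.Resp} {s : T₂.State}
    (hg : S.ghost t p = .pend i k l cont) (hl : A.act l = .op k o cont) (hR : ∀ r', ¬ R k i r')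
    (hs : T₂.step (st k) o r s) :
    A.Step input (S.simulated t st R) (.step p)
      (S.simulated t (Function.update st k s)
        fun k' i' r' => R k' i' r' ∨ k' = k ∧ i' = i ∧ r' = r) := by
  have hex : ∃ r', R k i r' ∨ r' = r := ⟨r, .inr rfl⟩
  -- No response was recorded for this operation before, so the one picked by choice in `Ghost.eval`
  -- must be `r`.
  have hch : hex.choose = r := hex.choose_spec.resolve_left (hR _)
  have h := Algorithm.Step.step (input := input) (S.simulated t st R) p l (cont r)
    ⟨Function.update st k s, (S.cfg t).mem.outer⟩
    (by simp [Trace.simulated, hg, Ghost.eval, hR]) (by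
      rw [hl]
      exact .op (S.simulated t st R).mem k o cont r s hs)
  convert h using 1
  unfold Trace.simulated
  congr 1
  funext q
  by_cases hq : q = p
  · subst hq
    simp [hg, Ghost.eval, hex, hch]
  · rw [Function.update_of_ne hq]
    change Ghost.eval _ (S.ghost t q) = Ghost.eval R (S.ghost t q)
    cases hgq : S.ghost t q with
    | plain l' => rfl
    | pend i' k' l' cont' =>
      have hne : ¬ (k' = k ∧ i' = i) := by
        rintro ⟨rfl, rfl⟩
        obtain ⟨_, ⟨o₁, h₁, _⟩, _⟩ := S.of_ghost_eq_pend hg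
        obtain ⟨_, ⟨o₂, h₂, _⟩, _⟩ := S.of_ghost_eq_pend hgq
        rw [h₁] at h₂
        cases h₂
        exact hq rfl
      have : ∀ r', (R k' i' r' ∨ k' = k ∧ i' = i ∧ r' = r) ↔ R k' i' r' := fun r' =>
        or_iff_left fun h => hne ⟨h.1, h.2.1⟩
      simp [Ghost.eval, this]

open Classical in
theorem Trace.path_of_applies (S : Trace A I input) {t : ℕ} {k : A.base.Obj} {s s' : T₂.State}
    {w : List (ℕ × T₂.Resp)} (h : Implementation.Applies (S.project k).ev s w s')
    (hg : ∀ x ∈ w, ∀ p o, (S.project k).ev x.1 = .inv p o →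
      ∃ l cont, S.ghost t p = .pend x.1 k l cont ∧ A.act l = .op k o cont)
    (hw : (w.map Prod.fst).Nodup) {st : A.base.Obj → T₂.State} (hst : st k = s)
    {R : A.base.Obj → ℕ → T₂.Resp → Prop} (hR : ∀ x ∈ w, ∀ r, ¬ R k x.1 r) :
    ∃ es, Path (A.Step input) (S.simulated t st R) es
        (S.simulated t (Function.update st k s') fun k' i r => R k' i r ∨ k' = k ∧ (i, r) ∈ w) ∧
      (∀ e ∈ es, ∃ p, e = .step p) ∧
      ∀ x ∈ w, ∀ p o, (S.project k).ev x.1 = .inv p o → .step p ∈ es := by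
  induction h generalizing st R with
  | nil s =>
    refine ⟨[], ?_, by simp, by simp⟩
    subst hst
    simpa using Path.nil _
  | cons s s' s'' i p o r w hi hs hw' ih =>
    subst hst
    obtain ⟨l, cont, hp, hl⟩ := hg (i, r) (by simp) p o hi
    have h₁ := S.step_simulated hp hl (hR (i, r) (by simp)) hs
    simp only [List.map_cons, List.nodup_cons] at hw
    obtain ⟨es, h₂, h₃, h₄⟩ := ih (fun x hx => hg x (by simp [hx])) hw.2
      (Function.update_self k s' st)
      (R := fun k' i' r' => R k' i' r' ∨ k' = k ∧ i' = i ∧ r' = r) (fun x hx r' hr' => by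
        rcases hr' with hr' | ⟨_, hr', _⟩
        · exact hR x (by simp [hx]) r' hr'
        · exact hw.1 (List.mem_map.2 ⟨x, hx, hr'⟩))
    refine ⟨_ :: es, .cons h₁ ?_, ?_, ?_⟩
    · rw [Function.update_idem] at h₂
      convert h₂ using 2
      funext k' i' r'
      simp only [List.mem_cons, Prod.mk.injEq, eq_iff_iff]
      tauto
    · simpa using h₃
    · intro x hx q o' hq
      rcases List.mem_cons.1 hx with rfl | hx
      · rw [hi] at hq
        cases hq
        simp
      · exact List.mem_cons_of_mem _ (h₄ x hx q o' hq)

section Linearized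

variable (S : Trace A I input)
  (L : ∀ k, Implementation.PersistentLinearization (S.project k) (A.base.objInit k))

/-- The operations linearized before time `t`, with their responses. -/
def linearized (t : ℕ) (k : A.base.Obj) (i : ℕ) (r : T₂.Resp) : Prop :=
  ∃ t' < t, (i, r) ∈ (L k).lin t'

noncomputable def simCfg (t : ℕ) : A.Config :=
  S.simulated t (fun k => (L k).state t) (linearized S L t)

variable {S}

theorem linearized_unique {t i : ℕ} {k : A.base.Obj} {r r' : T₂.Resp}
    (h : linearized S L t k i r) (h' : linearized S L t k i r') : r = r' := by
  obtain ⟨t₁, _, h⟩ := h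
  obtain ⟨t₂, _, h'⟩ := h'
  obtain rfl := (L k).unique _ _ _ _ _ h h'
  exact congrArg Prod.snd (List.inj_on_of_nodup_map ((L k).nodup t₁) h h' rfl)

open Classical in
-- The objects are handled one at a time; operations linearized at the same time on different
-- objects may be performed in any order.
theorem path_of_lin (t : ℕ) (ks : List A.base.Obj) (hks : ks.Nodup) :
    ∃ es, Path (A.Step input) (simCfg S L t) es
        (S.simulated t (fun k => if k ∈ ks then (L k).state (t + 1) else (L k).state t)
          fun k i r => linearized S L t k i r ∨ k ∈ ks ∧ (i, r) ∈ (L k).lin t) ∧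
      (∀ e ∈ es, ∃ p, e = .step p) ∧
      ∀ k ∈ ks, ∀ x ∈ (L k).lin t, ∀ p o, (S.project k).ev x.1 = .inv p o → .step p ∈ es := by
  induction ks with
  | nil =>
    refine ⟨[], ?_, by simp, by simp⟩
    simp only [List.not_mem_nil, if_false, false_and, or_false]
    exact .nil _
  | cons k ks ih =>
    obtain ⟨hk, hks⟩ := List.nodup_cons.1 hks
    obtain ⟨es, h₁, h₂, h₃⟩ := ih hks
    obtain ⟨es', h₁', h₂', h₃'⟩ := S.path_of_applies ((L k).legal t)
      (fun x hx p o => S.ghost_eq_pend_of_mem_lin (L k) (r := x.2) hx) ((L k).nodup t)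
      (st := fun k => if k ∈ ks then (L k).state (t + 1) else (L k).state t) (by simp [hk])
      (R := fun k i r => linearized S L t k i r ∨ k ∈ ks ∧ (i, r) ∈ (L k).lin t) (by
        rintro x hx r (⟨t', ht', hr⟩ | ⟨hk', _⟩)
        · exact ht'.ne ((L k).unique _ _ _ _ _ hr hx)
        · exact hk hk')
    refine ⟨es ++ es', h₁.append ?_, ?_, ?_⟩
    · convert h₁' using 2
      · funext k'
        by_cases hk' : k' = k
        · subst hk'; simp
        · simp [hk']
      · funext k' i r
        by_cases hk' : k' = k
        · subst hk'; simp [hk]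
        · simp [hk']
    · intro e he
      exact (List.mem_append.1 he).elim (h₂ e) (h₂' e)
    · intro k' hk' x hx p o ho
      rcases List.mem_cons.1 hk' with rfl | hk'
      · exact List.mem_append_right _ (h₃' x hx p o ho)
      · exact List.mem_append_left _ (h₃ k' hk' x hx p o ho)

theorem eq_of_applies_nil {ev : ℕ → Implementation.Event T₂ n} {s s' : T₂.State}
    (h : Implementation.Applies ev s [] s') : s' = s := by
  cases h; rfl

theorem exists_inv_of_applies {ev : ℕ → Implementation.Event T₂ n} {s s' : T₂.State}
    {w : List (ℕ × T₂.Resp)} (h : Implementation.Applies ev s w s') :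
    ∀ x ∈ w, ∃ p o, ev x.1 = .inv p o := by
  induction h with
  | nil => simp
  | cons s s' s'' i p o r w hi _ _ ih =>
    intro x hx
    rcases List.mem_cons.1 hx with rfl | hx
    · exact ⟨p, o, hi⟩
    · exact ih x hx

/-- An operation linearized at time `t` is pending then, and each of the `n` processes has at most
one pending operation. Without this, infinitely many objects could require infinitely many steps at
one time. -/
theorem finite_lin_ne_nil (t : ℕ) : {k | (L k).lin t ≠ []}.Finite := by
  let f : Fin n → Option A.base.Obj := fun p => match S.ghost t p with
    | .plain _ => none
    | .pend _ k _ _ => some k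
  refine ((Set.finite_range f).preimage (Option.some_injective _).injOn).subset fun k hk => ?_
  obtain ⟨x, hx⟩ := List.exists_mem_of_ne_nil _ hk
  obtain ⟨p, o, ho⟩ := exists_inv_of_applies ((L k).legal t) x hx
  obtain ⟨l, cont, hg, _⟩ := S.ghost_eq_pend_of_mem_lin (L k) (r := x.2) hx ho
  exact ⟨p, by simp [f, hg]⟩

/-- The operations linearized at time `t` can be performed in the simulation. -/
theorem exists_path_lin (t : ℕ) :
    ∃ es, Path (A.Step input) (simCfg S L t) es
        (S.simulated t (fun k => (L k).state (t + 1)) (linearized S L (t + 1))) ∧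
      (∀ e ∈ es, ∃ p, e = .step p) ∧
      ∀ k, ∀ x ∈ (L k).lin t, ∀ p o, (S.project k).ev x.1 = .inv p o → .step p ∈ es := by
  classical
  have hks : ∀ k, k ∈ (finite_lin_ne_nil L t).toFinset.toList ↔ (L k).lin t ≠ [] := by simp
  obtain ⟨es, h₁, h₂, h₃⟩ := path_of_lin L t _ (finite_lin_ne_nil L t).toFinset.nodup_toList
  refine ⟨es, ?_, h₂, fun k x hx => h₃ k ((hks k).2 (List.ne_nil_of_mem hx)) x hx⟩
  convert h₁ using 2
  · funext k
    split_ifs with hk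
    · rfl
    · rw [hks, not_not] at hk
      have := (L k).legal t
      rw [hk] at this
      exact eq_of_applies_nil this
  · funext k i r
    have : k ∈ (finite_lin_ne_nil L t).toFinset.toList ∧ (i, r) ∈ (L k).lin t ↔
        (i, r) ∈ (L k).lin t :=
      and_iff_right_of_imp fun h => (hks k).2 (List.ne_nil_of_mem h)
    rw [this, eq_iff_iff]
    constructor
    · rintro ⟨t', ht', h⟩
      rcases Nat.lt_succ_iff_lt_or_eq.1 ht' with ht' | rfl
      · exact .inl ⟨t', ht', h⟩
      · exact .inr h
    · rintro (⟨t', ht', h⟩ | h)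
      · exact ⟨t', by omega, h⟩
      · exact ⟨t, by omega, h⟩

/-- The event of the simulated execution. A crash is postponed to the start of the next run. -/
def Label.simulated : Label A → Algorithm.Event n D
  | .pre p => .crash p
  | .reg p _ => .step p
  | .out p v => .out p v
  | _ => .pass

theorem eval_update (R : A.base.Obj → ℕ → T₂.Resp → Prop) (g : Fin n → Ghost A) (p : Fin n)
    (x : Ghost A) : (fun q => (Function.update g p x q).eval R) =
      Function.update (fun q => (g q).eval R) p (x.eval R) := by
  funext q
  by_cases h : q = p
  · subst h; simp
  · simp [Function.update_of_ne h]

/-- Invocations and responses are invisible in the simulation: an operation has no effect yet when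
it is invoked, and its effect has already been evaluated when it returns. -/
theorem step_simCfg (t : ℕ) :
    A.Step input (S.simulated t (fun k => (L k).state (t + 1)) (linearized S L (t + 1)))
      (S.lab t).simulated (simCfg S L (t + 1)) := by
  have hs := S.next t
  have hm := S.matches t
  unfold simCfg Trace.simulated
  rw [Trace.ghost]
  generalize hlab : S.lab t = lab at hs ⊢
  generalize hc' : S.cfg (t + 1) = c' at hs ⊢
  generalize hc : S.cfg t = c at hs hm ⊢
  cases hs with
  | boot_none | boot_some | recStep | recovered | inner | crash | pass => exact .pass _
  | pre p hp =>
    simp only [Ghost.next]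
    rw [eval_update]
    exact .crash _ p
  | inv p l k o cont hp h =>
    have hg := hm p
    rw [hp] at hg
    simp only [Ghost.Matches] at hg
    -- The operation invoked at time `t` is linearized only later, so its ghost evaluates to the
    -- local state `l` before the operation.
    have : ¬ ∃ r, linearized S L (t + 1) k t r := by
      rintro ⟨r, t', ht', hr⟩
      have := (L k).after_inv _ _ _ hr
      omega
    simp only [Ghost.next]
    rw [eval_update]
    rw [(Function.update_eq_self_iff
      (f := fun q => (S.ghost t q).eval (linearized S L (t + 1)))).2]
    · exact .pass _
    simp [Ghost.eval, this, hg]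
  | read p l r cont hp h =>
    have hg := hm p
    rw [hp] at hg
    simp only [Ghost.Matches] at hg
    simp only [Ghost.next]
    rw [eval_update]
    refine .step _ p l _ _ (by simp [hg, Ghost.eval]) ?_
    rw [h]
    exact .read _ r cont
  | write p l r v l' hp h =>
    have hg := hm p
    rw [hp] at hg
    simp only [Ghost.Matches] at hg
    simp only [Ghost.next]
    rw [eval_update]
    refine .step _ p l _ _ (by simp [hg, Ghost.eval]) ?_
    rw [h]
    exact .write _ r v l'
  | resp p k cont l r hp h =>
    obtain ⟨i, l', hg⟩ : ∃ i l', S.ghost t p = .pend i k l' cont := by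
      have hg := hm p
      rw [hp] at hg
      exact hg
    -- The operation has been linearized with the response `r`, so its ghost already evaluates to
    -- `cont r`.
    obtain ⟨t', ht', hr⟩ := (L k).before_resp p i t r (S.returns hg hlab)
    have hlin : linearized S L (t + 1) k i r := ⟨t', by omega, hr⟩
    have hex : ∃ r, linearized S L (t + 1) k i r := ⟨r, hlin⟩
    simp only [Ghost.next]
    rw [eval_update]
    rw [(Function.update_eq_self_iff
      (f := fun q => (S.ghost t q).eval (linearized S L (t + 1)))).2]
    · exact .pass _
    simp [Ghost.eval, hg, hex, linearized_unique L hex.choose_spec hlin]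
  | out p l v hp h =>
    have hg := hm p
    rw [hp] at hg
    simp only [Ghost.Matches] at hg
    simp only [Ghost.next]
    rw [eval_update]
    exact .out _ p l v (by simp [hg, Ghost.eval]) h

theorem simCfg_zero : simCfg S L 0 = A.initial input := by
  unfold simCfg Trace.simulated Algorithm.initial Base.initial
  simp [S.init, Config.initial, Mem.initial, Trace.ghost, Ghost.eval,
    Implementation.PersistentLinearization.state_zero]

/-- The simulated execution of `A`; the events at the times from `τ t` on correspond to what happens
at time `t`. -/
theorem exists_simulated_execution :
    ∃ (E : A.Execution input) (τ : ℕ → ℕ), StrictMono τ ∧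
      (∀ t, ∃ s, τ t ≤ s ∧ E.ev s = (S.lab t).simulated) ∧
      (∀ t k, ∀ x ∈ (L k).lin t, ∀ p o, (S.project k).ev x.1 = .inv p o →
        ∃ s, τ t ≤ s ∧ E.ev s = .step p) ∧
      ∀ s, ∃ t, s < τ (t + 1) ∧ (E.ev s = (S.lab t).simulated ∨ ∃ p, E.ev s = .step p) := by
  choose es h₁ h₂ h₃ using exists_path_lin L
  obtain ⟨cfg, ev, τ, h₀, hnext, hτ, hmem, hinv⟩ := Path.exists_concat
    -- The final event, possibly `pass`, makes every path nonempty, as concatenation requires.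
    (fun t => (h₁ t).append (.cons (step_simCfg L t) (.nil _))) (by simp)
  refine ⟨⟨cfg, ev, h₀.trans (simCfg_zero L), hnext⟩, τ, hτ, fun t => hmem t _ (by simp),
    fun t k x hx p o ho => hmem t _ (by simp [h₃ t k x hx p o ho]), fun s => ?_⟩
  obtain ⟨t, ht, hs⟩ := hinv s
  refine ⟨t, ht, ?_⟩
  rcases List.mem_append.1 hs with hs | hs
  · exact .inr (h₂ t _ hs)
  · exact .inl (by simpa using hs)

end Linearized

/-! ### Progress -/

namespace Step

variable {c c' : Config A I} {lab : Label A} {p : Fin n}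

theorem loc_of_not_step (h : Step input c lab c') (h₁ : lab.event ≠ .crash p)
    (h₂ : lab.event ≠ .step p) : c'.loc p = c.loc p ∨ c'.loc p = none := by
  cases h with
  | pass => exact .inl rfl
  | out q =>
    by_cases hq : p = q
    · subst hq; exact .inr (by simp [Config.setLoc])
    · exact .inl (by simp [Config.setLoc, Function.update_of_ne hq])
  | crash q =>
    have hq : p ≠ q := fun e => h₁ (by rw [e]; rfl)
    exact .inl (by simp [Config.setLoc, Function.update_of_ne hq])
  | boot_none q | boot_some q | recStep q | recovered q | pre q | inv q | read q | write q
  | inner q | resp q =>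
    have hq : p ≠ q := fun e => h₂ (by rw [e]; rfl)
    exact .inl (by simp [Config.setLoc, Function.update_of_ne hq])

theorem loc_of_none (h : Step input c lab c') (h₁ : lab.event ≠ .crash p)
    (hp : c.loc p = none) : lab.event ≠ .step p ∧ c'.loc p = none := by
  have h₂ : lab.event ≠ .step p := by
    intro e
    cases h <;> cases e <;> simp_all
  exact ⟨h₂, (h.loc_of_not_step h₁ h₂).elim (fun e => e.trans hp) id⟩

theorem loc_of_boot (h : Step input c lab c') (h₁ : lab.event = .step p)
    (hp : c.loc p = some .boot) :
    c'.loc p = some .pre ∨ ∃ k l, c'.loc p = some (.recover k l) := by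
  cases h <;> cases h₁ <;> simp_all [Config.setLoc]

theorem loc_of_recover (h : Step input c lab c') (h₁ : lab.event = .step p) {k : A.base.Obj}
    {l : (I k).RecLoc} (hp : c.loc p = some (.recover k l)) :
    c'.loc p = some .pre ∨ lab = .recStep p k ∧ ∃ l', c'.loc p = some (.recover k l') := by
  cases h <;> cases h₁ <;> simp_all [Config.setLoc]
  all_goals
    obtain ⟨rfl, h⟩ := hp
    simp

theorem loc_of_pre (h : Step input c lab c') (h₁ : lab.event = .step p)
    (hp : c.loc p = some .pre) : ∃ l, c'.loc p = some (.run l) := by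
  cases h <;> cases h₁ <;> simp_all [Config.setLoc]

theorem loc_of_run (h : Step input c lab c') (h₁ : lab.event = .step p) {l : A.Loc}
    (hp : c.loc p = some (.run l)) :
    (∃ l', lab = .reg p l' ∧ c'.loc p = some (.run l')) ∨
      ∃ k o l₁ cont l', lab = .inv p k o l₁ cont ∧ c'.loc p = some (.busy k cont l') := by
  cases h <;> cases h₁ <;> simp_all [Config.setLoc]

theorem loc_of_busy (h : Step input c lab c') (h₁ : lab.event = .step p) {k : A.base.Obj}
    {cont : T₂.Resp → A.Loc} {l : (I k).Loc} (hp : c.loc p = some (.busy k cont l)) :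
    (∃ r l', lab = .resp p k r l' ∧ c'.loc p = some (.run l')) ∨
      lab = .inner p k ∧ ∃ l', c'.loc p = some (.busy k cont l') := by
  cases h <;> cases h₁ <;> simp_all [Config.setLoc]
  all_goals
    obtain ⟨rfl, rfl, h⟩ := hp
    simp

theorem loc_of_label_pre (h : Step input c (.pre p) c') : c.loc p = some .pre := by
  cases h; assumption

end Step

theorem Label.of_project_eq_crash {lab : Label A} {k : A.base.Obj} {p : Fin n}
    (h : lab.project k = .crash p) : lab.event = .crash p := by
  cases lab with
  | crash q k' =>
    simp only [Label.project] at h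
    split_ifs at h with hk
    cases h
    rfl
  | _ =>
    simp only [Label.project, reduceCtorEq] at h
    try split_ifs at h

namespace Trace

variable (S : Trace A I input) {p : Fin n} {t₀ : ℕ}

/-- From time `t₀` on, `p` does not crash, and it takes infinitely many steps. -/
structure Active (p : Fin n) (t₀ : ℕ) : Prop where
  not_crash : ∀ t, t₀ ≤ t → (S.lab t).event ≠ .crash p
  exists_step : ∀ t, ∃ u, t ≤ u ∧ (S.lab u).event = .step p

namespace Active

variable {S} (h : S.Active p t₀)

include h

theorem loc_ne_none {t : ℕ} (ht : t₀ ≤ t) : (S.cfg t).loc p ≠ none := by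
  intro e
  have key : ∀ u, t ≤ u → (S.cfg u).loc p = none := fun u hu => by
    induction u, hu using Nat.le_induction with
    | base => exact e
    | succ u hu ih => exact ((S.next u).loc_of_none (h.not_crash u (ht.trans hu)) ih).2
  obtain ⟨u, hu, hs⟩ := h.exists_step t
  exact ((S.next u).loc_of_none (h.not_crash u (ht.trans hu)) (key u hu)).1 hs

theorem loc_succ {t : ℕ} (ht : t₀ ≤ t) (hs : (S.lab t).event ≠ .step p) :
    (S.cfg (t + 1)).loc p = (S.cfg t).loc p :=
  ((S.next t).loc_of_not_step (h.not_crash t ht) hs).resolve_right (h.loc_ne_none (by omega))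

theorem exists_next_step {t : ℕ} (ht : t₀ ≤ t) :
    ∃ u, t ≤ u ∧ (S.lab u).event = .step p ∧ (S.cfg u).loc p = (S.cfg t).loc p := by
  classical
  have hex := h.exists_step t
  refine ⟨Nat.find hex, (Nat.find_spec hex).1, (Nat.find_spec hex).2, ?_⟩
  suffices ∀ u, t ≤ u → u ≤ Nat.find hex → (S.cfg u).loc p = (S.cfg t).loc p from
    this _ (Nat.find_spec hex).1 le_rfl
  intro u hu
  induction u, hu using Nat.le_induction with
  | base => intro _; rfl
  | succ u hu ih =>
    intro hle
    rw [h.loc_succ (ht.trans hu) fun e => Nat.find_min hex (by omega) ⟨hu, e⟩, ih (by omega)]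

/-- A process cannot be executing a routine of a wait-free implementation forever. -/
theorem not_forever {k : A.base.Obj} (hI : (I k).WaitFree) {t : ℕ} (ht : t₀ ≤ t)
    (hs : ∀ u, t ≤ u → (S.lab u).event = .step p → (S.lab u).project k = .step p)
    (hb : ∀ u, t ≤ u → Loc.status k ((S.cfg u).mem.cur p) p ((S.cfg u).loc p) ≠ .idle) :
    False := by
  obtain ⟨u, hu, hidle⟩ := hI (S.project k) p t
    (fun u hu e => h.not_crash u (ht.trans hu) (Label.of_project_eq_crash (lab := S.lab u) e))
    (fun u => by
      obtain ⟨v, hv, hstep⟩ := h.exists_step (max t u)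
      exact ⟨v, by omega, hs v (by omega) hstep⟩)
  exact hb u hu hidle

theorem exists_resp (hI : ∀ k, (I k).WaitFree) {t : ℕ} (ht : t₀ ≤ t) {k : A.base.Obj}
    {cont : T₂.Resp → A.Loc} {l : (I k).Loc} (hp : (S.cfg t).loc p = some (.busy k cont l)) :
    ∃ u r l', t ≤ u ∧ S.lab u = .resp p k r l' ∧ (S.cfg (u + 1)).loc p = some (.run l') := by
  by_contra! hne
  have hbusy : ∀ u, t ≤ u → ∃ l, (S.cfg u).loc p = some (.busy k cont l) := fun u hu => by
    induction u, hu using Nat.le_induction with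
    | base => exact ⟨l, hp⟩
    | succ u hu ih =>
      obtain ⟨l, hl⟩ := ih
      by_cases hs : (S.lab u).event = .step p
      · rcases (S.next u).loc_of_busy hs hl with ⟨r, l', h₁, h₂⟩ | ⟨_, h⟩
        · exact absurd h₂ (hne u r l' hu h₁)
        · exact h
      · exact ⟨l, by rw [h.loc_succ (ht.trans hu) hs, hl]⟩
  refine h.not_forever (hI k) ht (fun u hu hs => ?_) (fun u hu => ?_)
  · obtain ⟨l, hl⟩ := hbusy u hu
    rcases (S.next u).loc_of_busy hs hl with ⟨r, l', h₁, h₂⟩ | ⟨h, _⟩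
    · exact absurd h₂ (hne u r l' hu h₁)
    · simp [h, Label.project]
  · obtain ⟨l, hl⟩ := hbusy u hu
    simp [hl, Loc.status]

theorem exists_pre_of_recover (hI : ∀ k, (I k).WaitFree) {t : ℕ} (ht : t₀ ≤ t) {k : A.base.Obj}
    {l : (I k).RecLoc} (hp : (S.cfg t).loc p = some (.recover k l)) :
    ∃ u, t ≤ u ∧ (S.cfg u).loc p = some .pre := by
  by_contra! hne
  have hrec : ∀ u, t ≤ u → ∃ l, (S.cfg u).loc p = some (.recover k l) := fun u hu => by
    induction u, hu using Nat.le_induction with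
    | base => exact ⟨l, hp⟩
    | succ u hu ih =>
      obtain ⟨l, hl⟩ := ih
      by_cases hs : (S.lab u).event = .step p
      · exact (((S.next u).loc_of_recover hs hl).resolve_left (hne (u + 1) (by omega))).2
      · exact ⟨l, by rw [h.loc_succ (ht.trans hu) hs, hl]⟩
  refine h.not_forever (hI k) ht (fun u hu hs => ?_) (fun u hu => ?_)
  · obtain ⟨l, hl⟩ := hrec u hu
    have := (((S.next u).loc_of_recover hs hl).resolve_left (hne (u + 1) (by omega))).1
    simp [this, Label.project]
  · obtain ⟨l, hl⟩ := hrec u hu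
    simp [hl, Loc.status]

theorem exists_run_of_pre {t : ℕ} (ht : t₀ ≤ t) (hp : (S.cfg t).loc p = some .pre) :
    ∃ u l, t ≤ u ∧ (S.cfg u).loc p = some (.run l) := by
  obtain ⟨u, hu, hs, hl⟩ := h.exists_next_step ht
  obtain ⟨l, hl'⟩ := (S.next u).loc_of_pre hs (hl.trans hp)
  exact ⟨u + 1, l, by omega, hl'⟩

theorem exists_run_of_recover (hI : ∀ k, (I k).WaitFree) {t : ℕ} (ht : t₀ ≤ t) {k : A.base.Obj}
    {l : (I k).RecLoc} (hp : (S.cfg t).loc p = some (.recover k l)) :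
    ∃ u l, t ≤ u ∧ (S.cfg u).loc p = some (.run l) := by
  obtain ⟨u, hu, hl⟩ := h.exists_pre_of_recover hI ht hp
  obtain ⟨v, l, hv, hl⟩ := h.exists_run_of_pre (ht.trans hu) hl
  exact ⟨v, l, hu.trans hv, hl⟩

theorem exists_run (hI : ∀ k, (I k).WaitFree) {t : ℕ} (ht : t₀ ≤ t) :
    ∃ u l, t ≤ u ∧ (S.cfg u).loc p = some (.run l) := by
  obtain ⟨x, hx⟩ := Option.ne_none_iff_exists'.1 (h.loc_ne_none ht)
  cases x with
  | boot =>
    obtain ⟨u, hu, hs, hl⟩ := h.exists_next_step ht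
    rcases (S.next u).loc_of_boot hs (hl.trans hx) with hl | ⟨k, l, hl⟩
    · obtain ⟨v, l, hv, hl⟩ := h.exists_run_of_pre (by omega) hl
      exact ⟨v, l, by omega, hl⟩
    · obtain ⟨v, l, hv, hl⟩ := h.exists_run_of_recover hI (by omega) hl
      exact ⟨v, l, by omega, hl⟩
  | recover k l => exact h.exists_run_of_recover hI ht hx
  | pre => exact h.exists_run_of_pre ht hx
  | run l => exact ⟨t, l, le_rfl, hx⟩
  | busy k cont l =>
    obtain ⟨u, r, l', hu, _, hl⟩ := h.exists_resp hI ht hx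
    exact ⟨u + 1, l', by omega, hl⟩

/-- `p` does not start a new run after it has reached the routine of `A`. -/
theorem lab_ne_pre {t : ℕ} (ht : t₀ ≤ t) {l : A.Loc} (hp : (S.cfg t).loc p = some (.run l))
    {u : ℕ} (hu : t ≤ u) : S.lab u ≠ .pre p := by
  have key : (∃ l, (S.cfg u).loc p = some (.run l)) ∨
      ∃ k cont l, (S.cfg u).loc p = some (.busy k cont l) := by
    induction u, hu using Nat.le_induction with
    | base => exact .inl ⟨l, hp⟩
    | succ u hu ih =>
      by_cases hs : (S.lab u).event = .step p
      · rcases ih with ⟨l, hl⟩ | ⟨k, cont, l, hl⟩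
        · rcases (S.next u).loc_of_run hs hl with ⟨l', _, hl'⟩ | ⟨k, o, l₁, cont, l', _, hl'⟩
          · exact .inl ⟨l', hl'⟩
          · exact .inr ⟨k, cont, l', hl'⟩
        · rcases (S.next u).loc_of_busy hs hl with ⟨r, l', _, hl'⟩ | ⟨_, l', hl'⟩
          · exact .inl ⟨l', hl'⟩
          · exact .inr ⟨k, cont, l', hl'⟩
      · rwa [h.loc_succ (ht.trans hu) hs]
  intro e
  have := S.next u
  rw [e] at this
  have := this.loc_of_label_pre
  rcases key with ⟨l, hl⟩ | ⟨k, cont, l, hl⟩ <;> simp [hl] at this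

/-- `p` takes infinitely many steps in the simulation. -/
theorem exists_simulated_step (hI : ∀ k, (I k).WaitFree)
    (L : ∀ k, Implementation.PersistentLinearization (S.project k) (A.base.objInit k))
    {t : ℕ} (ht : t₀ ≤ t) : ∃ u, t ≤ u ∧ ((S.lab u).simulated = .step p ∨
      ∃ k, ∃ x ∈ (L k).lin u, ∃ o, (S.project k).ev x.1 = .inv p o) := by
  obtain ⟨u, l, hu, hl⟩ := h.exists_run hI ht
  obtain ⟨v, hv, hs, hl'⟩ := h.exists_next_step (ht.trans hu)
  rcases (S.next v).loc_of_run hs (hl'.trans hl) with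
    ⟨l', hlab, _⟩ | ⟨k, o, l₁, cont, l', hlab, hbusy⟩
  · exact ⟨v, by omega, .inl (by rw [hlab]; rfl)⟩
  · obtain ⟨w, r, l₂, hw, hr, _⟩ := h.exists_resp hI (by omega) hbusy
    obtain ⟨i, l₃, cont', hg⟩ : ∃ i l₃ cont', S.ghost w p = .pend i k l₃ cont' := by
      have hm := S.matches w p
      have hn := S.next w
      rw [hr] at hn
      generalize S.cfg w = c, S.cfg (w + 1) = c' at hn hm
      cases hn with
      | resp _ _ cont _ _ hp =>
        rw [hp] at hm
        obtain ⟨i, l, hm⟩ := hm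
        exact ⟨i, l, cont, hm⟩
    have hret := S.returns hg hr
    obtain ⟨hi, ⟨o', hlab', _⟩, hlast⟩ := S.of_ghost_eq_pend hg
    -- The pending operation is the last one invoked, hence not older than the invocation at `v`;
    -- its linearization point is therefore later than `t`.
    have hvi : v ≤ i := by
      by_contra hvi
      exact hlast v (by omega) (by omega) _ _ _ _ hlab
    obtain ⟨t', _, hlin⟩ := (L k).before_resp p i w r hret
    have := (L k).after_inv i r t' hlin
    obtain ⟨o, ho⟩ := hret.2.1
    exact ⟨t', by omega, .inr ⟨k, _, hlin, o, ho⟩⟩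

end Active

end Trace

/-! ### Correctness of the composed algorithm -/

theorem Label.eq_out_of_event {lab : Label A} {p : Fin n} {v : D} (h : lab.event = .out p v) :
    lab = .out p v := by
  cases lab <;> cases h
  rfl

theorem Label.eq_pre_of_simulated {lab : Label A} {p : Fin n} (h : lab.simulated = .crash p) :
    lab = .pre p := by
  cases lab <;> cases h
  rfl

/-- Safety transfers because `out` events are copied to the simulation; progress transfers because
an active process takes infinitely many simulated steps after its last simulated crash. -/
theorem solvesRC (hA : A.SolvesRC) (hI : ∀ k, (I k).WaitFree)
    (hL : ∀ k, (I k).PersistentlyLinearizable (A.base.objInit k)) :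
    (algorithm A I).SolvesRC where
  agreement input E p q v w t u ht hu := by
    obtain ⟨S, hS⟩ := exists_trace E
    obtain ⟨E', τ, _, hsim, _, _⟩ :=
      exists_simulated_execution fun k => (hL k (S.project k)).some
    obtain ⟨s, _, hs⟩ := hsim t
    obtain ⟨s', _, hs'⟩ := hsim u
    rw [Label.eq_out_of_event ((hS t).symm.trans ht)] at hs
    rw [Label.eq_out_of_event ((hS u).symm.trans hu)] at hs'
    exact hA.agreement input E' p q v w s s' hs hs'
  validity input E p v t ht := by
    obtain ⟨S, hS⟩ := exists_trace E
    obtain ⟨E', τ, _, hsim, _, _⟩ :=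
      exists_simulated_execution fun k => (hL k (S.project k)).some
    obtain ⟨s, _, hs⟩ := hsim t
    rw [Label.eq_out_of_event ((hS t).symm.trans ht)] at hs
    exact hA.validity input E' p v s hs
  waitFree input E p t₀ hcrash := by
    obtain ⟨S, hS⟩ := exists_trace E
    by_contra! hstep
    have h : S.Active p t₀ := ⟨fun t ht e => hcrash t ht ((hS t).trans e), fun t => by
      obtain ⟨u, hu, e⟩ := hstep t
      exact ⟨u, hu, (hS u).symm.trans e⟩⟩
    obtain ⟨E', τ, hτ, hsim, hlin, hev⟩ :=
      exists_simulated_execution fun k => (hL k (S.project k)).some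
    obtain ⟨t₁, l, ht₁, hl⟩ := h.exists_run hI le_rfl
    -- Simulated crashes of `p` come only from `pre p`, which does not occur once `p` has reached
    -- the routine of `A` at `t₁`.
    obtain ⟨s₁, hs₁⟩ := hA.waitFree input E' p (τ t₁) fun s hs e => by
      obtain ⟨t, ht, he⟩ := hev s
      have := hτ.lt_iff_lt.1 (hs.trans_lt ht)
      rcases he with he | ⟨q, he⟩
      · exact h.lab_ne_pre ht₁ hl (by omega) (Label.eq_pre_of_simulated (he.symm.trans e))
      · cases he.symm.trans e
    obtain ⟨t, ht, hs⟩ := h.exists_simulated_step hI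
      (fun k => (hL k (S.project k)).some) (le_max_left t₀ s₁)
    obtain ⟨s, hts, hs⟩ : ∃ s, τ t ≤ s ∧ E'.ev s = .step p := by
      rcases hs with hs | ⟨k, x, hx, o, ho⟩
      · exact (hsim t).imp fun s => And.imp_right (·.trans hs)
      · exact hlin t k x hx p o ho
    -- Since `t ≥ s₁`, the simulated step found lies beyond the bound `s₁`.
    have : t ≤ τ t := hτ.le_apply
    exact hs₁ s (by omega) hs

end Composition

/-! ### The number of processes -/

/-- Run the `m`-process algorithm with the additional processes never taking a step. -/
theorem RCSolvable.of_le {T : ObjType} {m n : ℕ} (hm : RCSolvable T m) (hnm : n ≤ m)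
    (hn : 0 < n) : RCSolvable T n := by
  intro D
  obtain ⟨A, hA⟩ := hm D
  let B : Algorithm T n D := ⟨A.base, A.Loc, fun p x => A.start (p.castLE hnm) x, A.act⟩
  -- The additional processes get the input of process `0`, so that every output is still the input
  -- of a real process; this needs `0 < n`.
  let pad : (Fin n → D) → Fin m → D := fun input q =>
    if h : q.1 < n then input ⟨q.1, h⟩ else input ⟨0, hn⟩
  let conf : (Fin n → D) → B.Config → A.Config := fun input c =>
    ⟨c.mem, fun q => if h : q.1 < n then c.loc ⟨q.1, h⟩ else some (A.start q (pad input q))⟩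
  let event : Algorithm.Event n D → Algorithm.Event m D := fun e => match e with
    | .step p => .step (p.castLE hnm)
    | .out p v => .out (p.castLE hnm) v
    | .crash p => .crash (p.castLE hnm)
    | .pass => .pass
  have hpad : ∀ input p, pad input (Fin.castLE hnm p) = input p := by intro input p; simp [pad]
  have hconf : ∀ input c p, (conf input c).loc (Fin.castLE hnm p) = c.loc p := by
    intro input c p; simp [conf]
  have hupd : ∀ input (c : B.Config) M p x, conf input ⟨M, Function.update c.loc p x⟩ =
      ⟨M, Function.update (conf input c).loc (Fin.castLE hnm p) x⟩ := by
    intro input c M p x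
    simp only [conf, Algorithm.Config.mk.injEq, true_and]
    funext q
    by_cases hq : q = p.castLE hnm
    · subst hq; simp
    · rw [Function.update_of_ne hq]
      split_ifs with h
      · rw [Function.update_of_ne]
        rintro rfl
        exact hq rfl
      · rfl
  have hnext : ∀ input c e c', B.Step input c e c' →
      A.Step (pad input) (conf input c) (event e) (conf input c') := by
    intro input c e c' h
    cases h with
    | step p l l' M hl h =>
      rw [hupd]
      exact Algorithm.Step.step (A := A) (conf input c) (p.castLE hnm) l l' M
        ((hconf ..).trans hl) h
    | out p l v hl h =>
      rw [hupd]
      exact Algorithm.Step.out (A := A) (conf input c) (p.castLE hnm) l v ((hconf ..).trans hl) h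
    | crash p =>
      rw [hupd]
      have := Algorithm.Step.crash (A := A) (input := pad input) (conf input c) (p.castLE hnm)
      rwa [hpad] at this
    | pass => exact .pass _
  have hexec : ∀ input (E : B.Execution input), ∃ E' : A.Execution (pad input),
      ∀ t, E'.ev t = event (E.ev t) := by
    intro input E
    refine ⟨⟨fun t => conf input (E.cfg t), fun t => event (E.ev t), ?_,
      fun t => hnext _ _ _ _ (E.next t)⟩, fun t => rfl⟩
    rw [E.init]
    simp only [conf, Algorithm.initial, Algorithm.Config.mk.injEq]
    refine ⟨rfl, ?_⟩
    funext q
    split_ifs with h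
    · simp [B, pad, h]
    · rfl
  refine ⟨B, fun input E p q v w t u ht hu => ?_, fun input E p v t ht => ?_,
    fun input E p t₀ hcrash => ?_⟩
  · obtain ⟨E', hE⟩ := hexec input E
    exact hA.agreement _ E' (p.castLE hnm) (q.castLE hnm) v w t u (by rw [hE, ht]) (by rw [hE, hu])
  · obtain ⟨E', hE⟩ := hexec input E
    obtain ⟨q, hq⟩ := hA.validity _ E' (p.castLE hnm) v t (by rw [hE, ht])
    simp only [pad] at hq
    split_ifs at hq
    · exact ⟨_, hq⟩
    · exact ⟨_, hq⟩
  · obtain ⟨E', hE⟩ := hexec input E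
    obtain ⟨t₁, h⟩ := hA.waitFree _ E' (p.castLE hnm) t₀ fun t ht e => by
      rw [hE] at e
      refine hcrash t ht ?_
      cases he : E.ev t <;> rw [he] at e <;> simp_all [event]
    exact ⟨t₁, fun t ht e => h t ht (by rw [hE, e])⟩

/-- If `n` processes could not solve the problem, no larger number could, and the supremum would be
at most `n - 1`. -/
theorem RCSolvable.of_le_rcons {T : ObjType} {n : ℕ} (hn : 0 < n) (h : (n : ℕ∞) ≤ rcons T) :
    RCSolvable T n := by
  by_contra hne
  have : rcons T ≤ ((n - 1 : ℕ) : ℕ∞) := iSup₂_le fun m hm => by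
    have : ¬ n ≤ m := fun hnm => hne (hm.of_le hnm hn)
    exact_mod_cast (by omega : m ≤ n - 1)
  have := Nat.cast_le.1 (h.trans this)
  omega

end RC

theorem theorem10 (T₁ T₂ : RC.ObjType) (n : ℕ)
    (hn : (n : ℕ∞) ≤ RC.rcons T₂)
    (himpl : RC.Implementable T₁ T₂ n) :
    (n : ℕ∞) ≤ RC.rcons T₁ := by
  -- The case `n = 0` is separate because passing to fewer processes needs a real process whose
  -- input can be copied.
  rcases Nat.eq_zero_or_pos n with rfl | hpos
  · simp
  refine le_iSup₂_of_le n (fun D => ?_) le_rfl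
  obtain ⟨A, hA⟩ := RC.RCSolvable.of_le_rcons hpos hn D
  choose I hI hL using himpl
  exact ⟨_, RC.Composition.solvesRC (I := fun k => I (A.base.objInit k)) hA
    (fun _ => hI _) fun _ => hL _⟩
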